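/- Let $N\ge 1$ be an integer and $s>0$ a real number. Let $\mathbb{S}_s=\{z\in\mathbb{C} : -s<\mathrm{Im}(z)<s\}$ with closure $\overline{\mathbb{S}}_s$. Let $\mathcal{A}(\mathbb{S}_s)$ be the space of complex-valued functions that are analytic on $\mathbb{S}_s$ and extend continuously to $\overline{\mathbb{S}}_s$ (we regard them as functions on $\overline{\mathbb{S}}_s$), and let $\mathcal{BA}(\mathbb{S}_s)$ be the subspace of those that are bounded on $\overline{\mathbb{S}}_s$. Let $G=(G_{nm})$ be a real $N\times N$ matrix which is diagonalisable over $\mathbb{R}$ and whose eigenvalues all lie in the open interval $(-2,2)$. Suppose that $G$ is non-negative (all entries are $\ge 0$) and irreducible (no permutation of the standard basis makes it block-upper-triangular with two non-empty diagonal blocks). Let $a_1,\dots,a_N\in\mathcal{A}(\mathbb{S}_s)$ be a valid asymptotics, i.e. for each $n$: $a_n$ is real-valued on $\mathbb{R}$; the functions $x\mapsto e^{-a_n(x)}$ and $x\mapsto \frac{d}{dx}e^{-a_n(x)}$ are bounded on $\mathbb{R}$; and $$a_n(x+is)+a_n(x-is)=\sum_{m=1}^N G_{nm}\,a_m(x)\qquad\text{for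 all }x\in\mathbb{R}.$$ Then there exist $Y_1,\dots,Y_N\in\mathcal{A}(\mathbb{S}_s)$ which solve the Y-system $$Y_n(x+is)\,Y_n(x-is)=\prod_{m=1}^N\bigl(1+Y_m(x)\bigr)^{G_{nm}}\qquad\text{for all }x\in\mathbb{R},\ n=1,\dots,N,$$ and satisfy, for $n=1,\dots,N$: 1. $Y_n(x)$ is real and positive for all $x\in\mathbb{R}$ (so the powers on the right-hand side are the usual powers of positive real numbers); 2. $Y_n(z)\ne 0$ for all $z\in\overline{\mathbb{S}}_s$; 3. $\log Y_n-a_n\in\mathcal{BA}(\mathbb{S}_s)$, where $\log Y_n$ denotes a function $h_n\in\mathcal{A}(\mathbb{S}_s)$ with $Y_n=e^{h_n}$ on $\overline{\mathbb{S}}_s$ (it is determined up to an additive constant in $2\pi i\mathbb{Z}$, which does not affect the condition). Moreover, this solution is unique: any $Y_1',\dots,Y_N'\in\mathcal{A}(\mathbb{S}_s)$ solving the Y-system and satisfying 1–3 coincide with $Y_1,\dots,Y_N$ on $\overline{\mathbb{S}}_s$. -/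

import Mathlib

namespace YSystem

/-- The open horizontal strip `{z : -s < Im z < s}` of height `2s`. -/
def strip (s : ℝ) : Set ℂ := {z : ℂ | -s < z.im ∧ z.im < s}

/-- The space `𝒜(S_s)`: functions analytic on the open strip which are continuous up to its closure.
Only the values on the closed strip are meaningful. -/
def A (s : ℝ) : Set (ℂ → ℂ) := {f | DiffContOnCl ℂ f (strip s)}

/-- The space `ℬ𝒜(S_s)`: those functions in `𝒜(S_s)` which are bounded on the closed strip. -/
def BA (s : ℝ) : Set (ℂ → ℂ) :=
  {f | f ∈ A s ∧ ∃ C : ℝ, ∀ z ∈ closure (strip s), ‖f z‖ ≤ C}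

/-- `G` can be diagonalised over the real numbers. -/
def IsDiagonalisable {N : ℕ} (G : Matrix (Fin N) (Fin N) ℝ) : Prop :=
  ∃ (P : Matrix (Fin N) (Fin N) ℝ) (d : Fin N → ℝ), IsUnit P ∧ G = P * Matrix.diagonal d * P⁻¹

/-- `Mat_{<2}(N)`: real matrices which are diagonalisable over `ℝ` and whose eigenvalues
lie in the open interval `(-2, 2)`. -/
def MatLT2 (N : ℕ) : Set (Matrix (Fin N) (Fin N) ℝ) :=
  {G | IsDiagonalisable G ∧
    ∀ μ : ℝ, Module.End.HasEigenvalue (Matrix.toLin' G) μ → -2 < μ ∧ μ < 2}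

/-- All entries are non-negative. -/
def IsNonneg {N : ℕ} (G : Matrix (Fin N) (Fin N) ℝ) : Prop := ∀ i j, 0 ≤ G i j

/-- `G` is irreducible: no permutation of the standard basis makes it block-upper-triangular (with
two non-empty diagonal blocks). Here `S` is the set of basis vectors which the permutation puts
into the first block; the lower left block is then the one with row index outside of `S` and column
index in `S`. (For `N = 1` every matrix is irreducible, including the zero matrix.) -/
def IsIrred {N : ℕ} (G : Matrix (Fin N) (Fin N) ℝ) : Prop :=
  ¬ ∃ S : Set (Fin N), S.Nonempty ∧ Sᶜ.Nonempty ∧ ∀ i ∈ Sᶜ, ∀ j ∈ S, G i j = 0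

/-- `a` is a valid asymptotics for the Y-system given by `G` and `s`. -/
structure IsValidAsymptotics {N : ℕ} (s : ℝ) (G : Matrix (Fin N) (Fin N) ℝ)
    (a : Fin N → ℂ → ℂ) : Prop where
  mem_A : ∀ n, a n ∈ A s
  real : ∀ n, ∀ x : ℝ, (a n (x : ℂ)).im = 0
  bounded_exp : ∀ n, ∃ C : ℝ, ∀ x : ℝ, ‖Complex.exp (-(a n (x : ℂ)))‖ ≤ C
  bounded_deriv_exp : ∀ n, ∃ C : ℝ, ∀ x : ℝ,
    ‖deriv (fun t : ℝ => Complex.exp (-(a n (t : ℂ)))) x‖ ≤ C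
  linear_eq : ∀ n, ∀ x : ℝ,
    a n ((x : ℂ) + Complex.I * (s : ℂ)) + a n ((x : ℂ) - Complex.I * (s : ℂ))
      = ∑ m, (G n m : ℂ) * a m (x : ℂ)

/-- The Y-system. The powers on the right are principal ones; for `Y m x > 0`, the only
case used, `1 + Y m x > 1` and they are the usual positive real powers. -/
def SolvesYSystem {N : ℕ} (s : ℝ) (G : Matrix (Fin N) (Fin N) ℝ) (Y : Fin N → ℂ → ℂ) : Prop :=
  ∀ n, ∀ x : ℝ,
    Y n ((x : ℂ) + Complex.I * (s : ℂ)) * Y n ((x : ℂ) - Complex.I * (s : ℂ))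
      = ∏ m, (1 + Y m (x : ℂ)) ^ (G n m : ℂ)

/-- `h` is a logarithm of `f` in `𝒜(S_s)`. Two of them differ by a constant in `2πiℤ`. -/
def IsLog (s : ℝ) (h f : ℂ → ℂ) : Prop :=
  h ∈ A s ∧ ∀ z ∈ closure (strip s), f z = Complex.exp (h z)

/-- `Y` is a solution of the Y-system in `𝒜(S_s)` which is real and positive on `ℝ`, has no roots
on the closed strip, and has asymptotics `a`. -/
structure IsGoodSolution {N : ℕ} (s : ℝ) (G : Matrix (Fin N) (Fin N) ℝ)
    (a Y : Fin N → ℂ → ℂ) : Prop where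
  mem_A : ∀ n, Y n ∈ A s
  solves : SolvesYSystem s G Y
  real_pos : ∀ n, ∀ x : ℝ, (Y n (x : ℂ)).im = 0 ∧ 0 < (Y n (x : ℂ)).re
  no_roots : ∀ n, ∀ z ∈ closure (strip s), Y n z ≠ 0
  asymptotics : ∀ n, ∃ h : ℂ → ℂ, IsLog s h (Y n) ∧ (fun z => h z - a n z) ∈ BA s

end YSystem

/-!
After rescaling, `s = π / 2`. Writing `Y n = exp (a n + f n)` with `f n` bounded, the Y-system
becomes the boundary equation
`f n (x + iπ/2) + f n (x - iπ/2) = ∑ m, G n m * log (exp (-a m x) + exp (f m x))`,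
whose right-hand side is `source` (the linear equation for `a` removes the unbounded part).

A boundary equation `f (x + iπ/2) + f (x - iπ/2) = g x` is solved by the convolution of `g` with the
kernel `1 / (2π cosh)`, and the solution is unique among bounded functions
(`eq_zero_of_boundary_antisymm`, from the Phragmén–Lindelöf principle applied to the exponential of
`f + conj ∘ f ∘ conj`, which is purely imaginary on the boundary). So on the real line the Y-system
is equivalent to the integral equation `r n = sechConv (source G α r n)` for bounded continuous real
functions.

The kernel is positive with integral `1 / 2`, and `r ↦ log (exp (-α) + exp r)` is `1`-Lipschitz.
Hence the integral operator contracts the vector of sup-distances by the non-negative matrix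
`G / 2`. Since `G` is diagonalisable with eigenvalues in `(-2, 2)`, the powers of `G / 2` tend to
zero, some iterate of the operator is a contraction, and the integral equation has exactly one
solution (`existsUnique_integral_equation`).

The remaining analytic point is that the convolution extends continuously to the closed strip
(`exists_mem_BA_boundary_sum`). This needs more than continuity of `g`: the fixed point is Lipschitz
by Cauchy's estimate, and `exp (-a)` is Lipschitz on the real line by assumption, so `g` is
Lipschitz. Then the derivative of the convolution at `z` is at most a constant times
`(cos (Im z)) ^ (-1/2)`, which is integrable up to the boundary. The boundary equation itself holds
because the sum of the kernel at `u + iη` and `u - iη` is a Poisson kernel, an approximate identity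
as `η → π / 2`.
-/

namespace YSystem

open MeasureTheory Set Filter Topology Complex
open scoped BoundedContinuousFunction

/-! ### The kernel `1 / cosh` on the strip of half-height `π / 2` -/

theorem norm_cosh_sq (z : ℂ) :
    ‖Complex.cosh z‖ ^ 2 = Real.sinh z.re ^ 2 + Real.cos z.im ^ 2 := by
  have h : Complex.cosh z = ((Real.cosh z.re * Real.cos z.im : ℝ) : ℂ)
      + ((Real.sinh z.re * Real.sin z.im : ℝ) : ℂ) * I := by
    conv_lhs => rw [← Complex.re_add_im z]
    rw [Complex.cosh_add, Complex.cosh_mul_I, Complex.sinh_mul_I]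
    push_cast
    ring
  rw [h, ← Complex.normSq_eq_norm_sq, Complex.normSq_add_mul_I]
  have h1 := Real.cosh_sq z.re
  have h2 := Real.sin_sq_add_cos_sq z.im
  linear_combination (Real.cos z.im ^ 2) * h1 + Real.sinh z.re ^ 2 * h2

theorem norm_sinh_le (z : ℂ) : ‖Complex.sinh z‖ ≤ Real.cosh z.re := by
  rw [Complex.sinh, Real.cosh_eq]
  have h := norm_sub_le (Complex.exp z) (Complex.exp (-z))
  rw [norm_div, Complex.norm_exp, Complex.norm_exp] at *
  simp only [Complex.neg_re, RCLike.norm_ofNat] at *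
  gcongr

theorem cosh_mul_cos_le_norm_cosh (z : ℂ) :
    Real.cosh z.re * Real.cos z.im ≤ ‖Complex.cosh z‖ := by
  refine (abs_le_of_sq_le_sq' ?_ (norm_nonneg _)).2
  rw [norm_cosh_sq, mul_pow, Real.cosh_sq]
  nlinarith [sq_nonneg (Real.sinh z.re), Real.sin_sq_add_cos_sq z.im,
    mul_nonneg (sq_nonneg (Real.sinh z.re)) (sq_nonneg (Real.sin z.im))]

theorem abs_mul_exp_le_two_mul_abs_sinh (u : ℝ) :
    |u| * Real.exp (|u| / 2) ≤ 2 * |Real.sinh u| := by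
  rw [Real.abs_sinh]
  obtain ⟨t, ht⟩ : ∃ t, |u| = 2 * t := ⟨|u| / 2, by ring⟩
  have ht0 : 0 ≤ t := by have := abs_nonneg u; linarith
  rw [ht, Real.sinh_two_mul]
  have h1 := Real.self_le_sinh_iff.2 ht0
  have h2 : Real.exp t / 2 ≤ Real.cosh t := by
    rw [Real.cosh_eq]; linarith [Real.exp_pos (-t)]
  have : 2 * t / 2 = t := by ring
  rw [this]
  have := mul_le_mul h1 h2 (by positivity) (ht0.trans h1)
  linarith

/-- A weight which dominates `1 / |cosh (u + i η)|` up to the factor `(cos η) ^ (-1/2)`. Its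
integrability at `0` is what makes `∫ |cosh (u + i η)|⁻¹ du` grow only like `(cos η) ^ (-1/2)`. -/
noncomputable def weight (u : ℝ) : ℝ :=
  (1 + |u|) * (|u| ^ (-(1 / 2) : ℝ) * Real.exp (-(1 / 4) * |u|))

theorem weight_nonneg (u : ℝ) : 0 ≤ weight u := by unfold weight; positivity

theorem integrable_comp_abs_of_integrableOn_Ioi {f : ℝ → ℝ} (hf : IntegrableOn f (Ioi 0)) :
    Integrable (fun x => f |x|) := by
  have h1 : IntegrableOn (fun x => f |x|) (Ioi 0) :=
    hf.congr_fun (fun x hx => by simp only [abs_of_pos (mem_Ioi.1 hx)]) measurableSet_Ioi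
  have h2 : IntegrableOn (fun x => f |x|) (Iic 0) := by
    rw [integrableOn_Iic_iff_integrableOn_Iio]
    have := h1.comp_neg
    simpa using this
  rw [← integrableOn_univ, ← Iic_union_Ioi (a := (0 : ℝ))]
  exact h2.union h1

theorem integrable_weight : Integrable weight := by
  have h1 := integrableOn_rpow_mul_exp_neg_mul_rpow (p := 1) (s := -(1 / 2)) (b := 1 / 4)
    (by norm_num) one_pos (by norm_num)
  have h2 := integrableOn_rpow_mul_exp_neg_mul_rpow (p := 1) (s := 1 / 2) (b := 1 / 4)
    (by norm_num) one_pos (by norm_num)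
  refine integrable_comp_abs_of_integrableOn_Ioi
    (f := fun u => (1 + u) * (u ^ (-(1 / 2) : ℝ) * Real.exp (-(1 / 4) * u))) ?_
  refine (h1.add h2).congr_fun (fun u hu => ?_) measurableSet_Ioi
  have h0 : (0 : ℝ) < u := hu
  have : u ^ (1 / 2 : ℝ) = u * u ^ (-(1 / 2) : ℝ) := by
    rw [← Real.rpow_one_add' h0.le (by norm_num)]; norm_num
  simp only [Pi.add_apply, Real.rpow_one, this]
  ring

/-- The point `z.re = 0` is excluded because `weight 0 = 0`: there `0 ^ (-1/2)` is `0` in Lean. -/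
theorem inv_norm_cosh_mul_le (z : ℂ) (hz : 0 < Real.cos z.im) (hu : z.re ≠ 0) :
    (1 + |z.re|) * ‖Complex.cosh z‖⁻¹ ≤ (Real.sqrt (Real.cos z.im))⁻¹ * weight z.re := by
  have hu' : 0 < |z.re| := abs_pos.2 hu
  have key : Real.sqrt (Real.cos z.im) * (|z.re| ^ (1 / 2 : ℝ) * Real.exp (1 / 4 * |z.re|))
      ≤ ‖Complex.cosh z‖ := by
    refine (abs_le_of_sq_le_sq' ?_ (norm_nonneg _)).2
    rw [norm_cosh_sq, mul_pow, mul_pow, Real.sq_sqrt hz.le, ← Real.sqrt_eq_rpow,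
      Real.sq_sqrt hu'.le, ← Real.exp_nat_mul]
    have h1 := abs_mul_exp_le_two_mul_abs_sinh z.re
    have h2 : ((2 : ℕ) : ℝ) * (1 / 4 * |z.re|) = |z.re| / 2 := by push_cast; ring
    rw [h2]
    have h3 := two_mul_le_add_sq |Real.sinh z.re| (Real.cos z.im)
    rw [sq_abs] at h3
    nlinarith [mul_le_mul_of_nonneg_left h1 hz.le]
  have hpos : 0 < Real.sqrt (Real.cos z.im)
      * (|z.re| ^ (1 / 2 : ℝ) * Real.exp (1 / 4 * |z.re|)) := by
    have := Real.sqrt_pos.2 hz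
    positivity
  have h4 := inv_anti₀ hpos key
  rw [mul_inv, mul_inv, ← Real.rpow_neg hu'.le, ← Real.exp_neg, ← neg_mul] at h4
  calc _ ≤ (1 + |z.re|) * _ := mul_le_mul_of_nonneg_left h4 (by positivity)
    _ = _ := by unfold weight; ring

theorem inv_norm_cosh_le (z : ℂ) (hz : 0 < Real.cos z.im) (hu : z.re ≠ 0) :
    ‖Complex.cosh z‖⁻¹ ≤ (Real.sqrt (Real.cos z.im))⁻¹ * weight z.re := by
  refine le_trans ?_ (inv_norm_cosh_mul_le z hz hu)
  have h1 : 0 ≤ ‖Complex.cosh z‖⁻¹ := by positivity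
  nlinarith [abs_nonneg z.re, mul_nonneg (abs_nonneg z.re) h1]

theorem cosh_ne_zero_of_cos_pos {z : ℂ} (hz : 0 < Real.cos z.im) : Complex.cosh z ≠ 0 := by
  have := cosh_mul_cos_le_norm_cosh z
  have h2 := mul_pos (Real.cosh_pos z.re) hz
  exact norm_pos_iff.1 (h2.trans_le this)

/-- The Poisson kernel of the strip, up to normalisation: the sum of `1 / cosh` at two conjugate
points. -/
noncomputable def poisson (η u : ℝ) : ℝ :=
  2 * (Real.cosh u * Real.cos η) / (Real.sinh u ^ 2 + Real.cos η ^ 2)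

theorem inv_cosh_add_inv_cosh (η u : ℝ) (hη : 0 < Real.cos η) :
    (Complex.cosh (u + η * I))⁻¹ + (Complex.cosh (u - η * I))⁻¹ = (poisson η u : ℂ) := by
  have e1 : (starRingEnd ℂ) (u + η * I) = u - η * I := by simp [sub_eq_add_neg]
  have h0 : Complex.cosh (u + η * I) ≠ 0 := cosh_ne_zero_of_cos_pos (by simpa using hη)
  have hsum : Complex.cosh (u + η * I) + Complex.cosh (u - η * I)
      = ((2 * (Real.cosh u * Real.cos η) : ℝ) : ℂ) := by
    rw [Complex.cosh_add, Complex.cosh_sub, Complex.cosh_mul_I]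
    push_cast
    ring
  have hmul : Complex.cosh (u + η * I) * Complex.cosh (u - η * I)
      = ((Real.sinh u ^ 2 + Real.cos η ^ 2 : ℝ) : ℂ) := by
    rw [← e1, Complex.cosh_conj, Complex.mul_conj, Complex.normSq_eq_norm_sq, norm_cosh_sq]
    simp
  have h1 : Complex.cosh (u - η * I) ≠ 0 := by
    rw [← e1, Complex.cosh_conj]; simpa using h0
  rw [inv_add_inv h0 h1, hsum, hmul, poisson, Complex.ofReal_div]

theorem poisson_nonneg (η u : ℝ) (hη : 0 ≤ Real.cos η) : 0 ≤ poisson η u := by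
  unfold poisson
  have := Real.cosh_pos u
  positivity

/-- The Poisson kernel is the derivative of `u ↦ 2 arctan (sinh u / cos η)`. -/
theorem hasDerivAt_poisson_primitive (η u : ℝ) (hη : 0 < Real.cos η) :
    HasDerivAt (fun u => 2 * Real.arctan (Real.sinh u / Real.cos η)) (poisson η u) u := by
  have h := (((Real.hasDerivAt_sinh u).div_const (Real.cos η)).arctan).const_mul 2
  have e : poisson η u
      = 2 * (1 / (1 + (Real.sinh u / Real.cos η) ^ 2) * (Real.cosh u / Real.cos η)) := by
    unfold poisson
    have : Real.sinh u ^ 2 + Real.cos η ^ 2 ≠ 0 := by positivity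
    have h3 : 1 + (Real.sinh u / Real.cos η) ^ 2 ≠ 0 := by positivity
    field_simp
    ring
  rwa [e]

theorem tendsto_poisson_primitive_atTop (η : ℝ) (hη : 0 < Real.cos η) :
    Tendsto (fun u => 2 * Real.arctan (Real.sinh u / Real.cos η)) atTop (𝓝 Real.pi) := by
  have h0 : Tendsto Real.sinh atTop atTop :=
    tendsto_atTop_mono' _ ((eventually_ge_atTop 0).mono fun x hx => Real.self_le_sinh_iff.2 hx)
      tendsto_id
  have h1 := (tendsto_nhds_of_tendsto_nhdsWithin
    (Real.tendsto_arctan_atTop.comp (h0.atTop_div_const hη))).const_mul 2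
  rwa [mul_div_cancel₀ _ two_ne_zero] at h1

theorem tendsto_poisson_primitive_atBot (η : ℝ) (hη : 0 < Real.cos η) :
    Tendsto (fun u => 2 * Real.arctan (Real.sinh u / Real.cos η)) atBot (𝓝 (-Real.pi)) := by
  have h := ((tendsto_poisson_primitive_atTop η hη).comp tendsto_neg_atBot_atTop).neg
  refine h.congr fun u => ?_
  simp [Real.sinh_neg, neg_div, Real.arctan_neg]

theorem integrable_poisson (η : ℝ) (hη : 0 < Real.cos η) : Integrable (poisson η) := by
  refine (integrable_comp_abs_of_integrableOn_Ioi
    (integrableOn_Ioi_deriv_of_nonneg' (fun x _ => hasDerivAt_poisson_primitive η x hη)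
      (fun x _ => poisson_nonneg η x hη.le) (tendsto_poisson_primitive_atTop η hη))).congr
    (ae_of_all _ fun u => ?_)
  simp only [poisson, Real.cosh_abs, ← Real.abs_sinh, sq_abs]

theorem integral_poisson (η : ℝ) (hη : 0 < Real.cos η) : ∫ u, poisson η u = 2 * Real.pi := by
  rw [integral_of_hasDerivAt_of_tendsto (fun x => hasDerivAt_poisson_primitive η x hη)
    (integrable_poisson η hη) (tendsto_poisson_primitive_atBot η hη)
    (tendsto_poisson_primitive_atTop η hη)]
  ring

theorem poisson_zero (u : ℝ) : poisson 0 u = 2 * (Real.cosh u)⁻¹ := by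
  have := Real.cosh_pos u
  rw [poisson, Real.cos_zero, one_pow, ← Real.cosh_sq]
  field_simp

theorem integrable_inv_cosh : Integrable (fun u => (Real.cosh u)⁻¹) := by
  have h := (integrable_poisson 0 (by simp)).const_mul (1 / 2)
  refine h.congr (ae_of_all _ fun u => ?_)
  simp only [poisson_zero]
  ring

theorem integral_inv_cosh : ∫ u, (Real.cosh u)⁻¹ = Real.pi := by
  have h := integral_poisson 0 (by simp)
  simp only [poisson_zero, integral_const_mul] at h
  linarith

/-- The Poisson kernel concentrates at `0` as `cos η → 0`. -/
theorem poisson_mul_abs_le (η u : ℝ) (hη : 0 < Real.cos η) (hu : u ≠ 0) :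
    poisson η u * |u| ≤ 2 * Real.sqrt (Real.cos η) * weight u := by
  obtain ⟨z, hre, him⟩ : ∃ z : ℂ, z.re = u ∧ z.im = η := ⟨⟨u, η⟩, rfl, rfl⟩
  have hz : 0 < Real.cos z.im := by rwa [him]
  have h1 := inv_norm_cosh_mul_le z hz (by rwa [hre])
  have hN : 0 < ‖Complex.cosh z‖ := norm_pos_iff.2 (cosh_ne_zero_of_cos_pos hz)
  have hsq := norm_cosh_sq z
  rw [hre, him] at *
  set N := ‖Complex.cosh z‖ with hNdef
  have h2 : |Real.sinh u| ≤ N := by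
    refine (abs_le_of_sq_le_sq' ?_ hN.le).2
    rw [hsq, sq_abs]; nlinarith [sq_nonneg (Real.cos η)]
  have h3 : Real.cosh u * |u| ≤ |Real.sinh u| * (1 + |u|) := by
    have ha : |u| ≤ |Real.sinh u| := by
      rw [Real.abs_sinh]; exact Real.self_le_sinh_iff.2 (abs_nonneg u)
    have hb : Real.cosh u ≤ |Real.sinh u| + 1 := by
      refine (abs_le_of_sq_le_sq' ?_ (by positivity)).2
      rw [Real.cosh_sq, ← sq_abs (Real.sinh u)]; nlinarith [abs_nonneg (Real.sinh u)]
    nlinarith [mul_le_mul_of_nonneg_right hb (abs_nonneg u)]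
  have h4 : Real.cosh u * |u| ≤ N * (1 + |u|) :=
    h3.trans (mul_le_mul_of_nonneg_right h2 (by positivity))
  have hs : 0 < Real.sqrt (Real.cos η) := Real.sqrt_pos.2 hη
  have hss : Real.cos η = Real.sqrt (Real.cos η) * Real.sqrt (Real.cos η) :=
    (Real.mul_self_sqrt hη.le).symm
  calc poisson η u * |u| = 2 * Real.cos η * (Real.cosh u * |u|) / N ^ 2 := by
        rw [poisson, hsq]; ring
    _ ≤ 2 * Real.cos η * (N * (1 + |u|)) / N ^ 2 := by gcongr
    _ = 2 * Real.cos η * ((1 + |u|) * N⁻¹) := by field_simp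
    _ ≤ 2 * Real.cos η * ((Real.sqrt (Real.cos η))⁻¹ * weight u) := by gcongr
    _ = 2 * Real.sqrt (Real.cos η) * weight u := by
        rw [hss, Real.sqrt_mul_self hs.le]; field_simp

/-! ### Convolution with `1 / cosh` -/

theorem cos_im_pos_of_mem_strip {z : ℂ} (hz : z ∈ strip (Real.pi / 2)) : 0 < Real.cos z.im :=
  Real.cos_pos_of_mem_Ioo ⟨by linarith [hz.1], hz.2⟩

/-- The analytic function on the strip `|Im z| < π / 2` whose boundary values satisfy
`F (x + iπ/2) + F (x - iπ/2) = g x`: the convolution of `g` with `1 / (2π cosh)`. -/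
noncomputable def stripExt (g : ℝ → ℝ) (z : ℂ) : ℂ :=
  (2 * Real.pi : ℂ)⁻¹ * ∫ y : ℝ, (g y : ℂ) * (Complex.cosh (z - y))⁻¹

/-- The restriction of `stripExt g` to the real line. -/
noncomputable def sechConv (g : ℝ → ℝ) (x : ℝ) : ℝ :=
  (2 * Real.pi)⁻¹ * ∫ y : ℝ, g y * (Real.cosh (x - y))⁻¹

theorem stripExt_ofReal (g : ℝ → ℝ) (x : ℝ) : stripExt g x = sechConv g x := by
  unfold stripExt sechConv
  push_cast
  rw [← integral_complex_ofReal]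
  push_cast
  rfl

theorem norm_inv_cosh_le (z : ℂ) (hz : 0 < Real.cos z.im) :
    ‖(Complex.cosh z)⁻¹‖ ≤ (Real.cos z.im)⁻¹ * (Real.cosh z.re)⁻¹ := by
  rw [norm_inv, ← mul_inv]
  refine inv_anti₀ (mul_pos hz (Real.cosh_pos _)) ?_
  rw [mul_comm]
  exact cosh_mul_cos_le_norm_cosh z

theorem integrable_mul_inv_cosh {g : ℝ → ℝ} (hg : Continuous g) {M : ℝ} (hM : ∀ x, |g x| ≤ M)
    {z : ℂ} (hz : 0 < Real.cos z.im) :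
    Integrable fun y : ℝ => (g y : ℂ) * (Complex.cosh (z - y))⁻¹ := by
  have hb : Integrable fun y : ℝ => M * ((Real.cos z.im)⁻¹ * (Real.cosh (z.re - y))⁻¹) :=
    ((integrable_inv_cosh.comp_sub_left z.re).const_mul _).const_mul _
  have hm : Continuous fun y : ℝ => (g y : ℂ) * (Complex.cosh (z - y))⁻¹ := by
    refine (Complex.continuous_ofReal.comp hg).mul (Continuous.inv₀ (by fun_prop) fun y => ?_)
    exact cosh_ne_zero_of_cos_pos (by simpa using hz)
  refine hb.mono' hm.aestronglyMeasurable (ae_of_all _ fun y => ?_)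
  have h := norm_inv_cosh_le (z - y) (by simpa using hz)
  simp only [Complex.sub_im, Complex.ofReal_im, sub_zero, Complex.sub_re, Complex.ofReal_re] at h
  rw [norm_mul, Complex.norm_real]
  exact mul_le_mul (hM y) h (norm_nonneg _) ((abs_nonneg _).trans (hM y))

theorem stripExt_eq_integral (g : ℝ → ℝ) (z : ℂ) :
    stripExt g z
      = (2 * Real.pi : ℂ)⁻¹ * ∫ u : ℝ, (g (z.re - u) : ℂ) * (Complex.cosh (u + z.im * I))⁻¹ := by
  unfold stripExt
  rw [← integral_sub_left_eq_self (fun y : ℝ => (g y : ℂ) * (Complex.cosh (z - y))⁻¹) volume z.re]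
  congr 2
  ext u
  congr 3
  push_cast
  linear_combination -(Complex.re_add_im z)

theorem integrable_mul_inv_cosh' {g : ℝ → ℝ} (hg : Continuous g) {M : ℝ} (hM : ∀ x, |g x| ≤ M)
    (x : ℝ) {η : ℝ} (hη : 0 < Real.cos η) :
    Integrable fun u : ℝ => (g (x - u) : ℂ) * (Complex.cosh (u + η * I))⁻¹ := by
  have h := (integrable_mul_inv_cosh (z := x + η * I) hg hM (by simpa using hη)).comp_sub_left x
  refine h.congr (ae_of_all _ fun u => ?_)
  have e : (x + η * I : ℂ) - ((x - u : ℝ) : ℂ) = u + η * I := by push_cast; ring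
  simp only [e]

theorem inv_cosh_sub_le (x y : ℝ) :
    (Real.cosh (x - y))⁻¹ ≤ 2 * Real.exp |x| * (Real.cosh y)⁻¹ := by
  have h1 : Real.cosh y ≤ Real.exp |y| := by
    rw [← Real.cosh_abs, Real.cosh_eq]
    have : Real.exp (-|y|) ≤ Real.exp |y| := Real.exp_le_exp.2 (by linarith [abs_nonneg y])
    linarith
  have h2 : Real.exp |x - y| ≤ 2 * Real.cosh (x - y) := by
    rw [← Real.cosh_abs (x - y), Real.cosh_eq]
    linarith [Real.exp_pos (-|x - y|)]
  have h3 : Real.exp |y| ≤ Real.exp |x| * Real.exp |x - y| := by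
    rw [← Real.exp_add]
    refine Real.exp_le_exp.2 ?_
    have := abs_sub x (x - y)
    rwa [sub_sub_cancel] at this
  have hp := Real.cosh_pos (x - y)
  have hq := Real.cosh_pos y
  rw [← div_eq_mul_inv, inv_le_comm₀ hp (by positivity), inv_div, div_le_iff₀ (by positivity)]
  nlinarith [Real.exp_pos |x|]

theorem differentiableAt_stripExt {g : ℝ → ℝ} (hg : Continuous g) {M : ℝ}
    (hM : ∀ x, |g x| ≤ M) {z₀ : ℂ} (hz₀ : 0 < Real.cos z₀.im) :
    DifferentiableAt ℂ (stripExt g) z₀ := by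
  -- On the neighbourhood `U` of `z₀` the derivative of the kernel is dominated uniformly.
  set c := Real.cos z₀.im / 2 with hc
  have hc0 : 0 < c := half_pos hz₀
  set U : Set ℂ := {z | c < Real.cos z.im ∧ |z.re| < |z₀.re| + 1} with hU
  have hUo : IsOpen U := by
    exact (isOpen_lt continuous_const (Real.continuous_cos.comp Complex.continuous_im)).inter
      (isOpen_lt Complex.continuous_re.abs continuous_const)
  have hzU : z₀ ∈ U := ⟨by rw [hc]; linarith, by linarith⟩
  have hM0 : 0 ≤ M := (abs_nonneg _).trans (hM 0)
  have key := hasDerivAt_integral_of_dominated_loc_of_deriv_le (μ := volume) (𝕜 := ℂ) (x₀ := z₀)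
    (s := U) (F := fun z y => (g y : ℂ) * (Complex.cosh (z - y))⁻¹)
    (F' := fun z y => (g y : ℂ) * (-(Complex.sinh (z - y)) / Complex.cosh (z - y) ^ 2))
    (bound := fun y => M * ((c ^ 2)⁻¹ * (2 * Real.exp (|z₀.re| + 1) * (Real.cosh y)⁻¹)))
    (hUo.mem_nhds hzU) ?_ (integrable_mul_inv_cosh hg hM hz₀) ?_ ?_ ?_ ?_
  · exact (key.2.differentiableAt).const_mul _
  · filter_upwards [hUo.mem_nhds hzU] with z hz
    exact (integrable_mul_inv_cosh hg hM (hc0.trans hz.1)).aestronglyMeasurable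
  · refine Continuous.aestronglyMeasurable ?_
    refine (Complex.continuous_ofReal.comp hg).mul (Continuous.div (by fun_prop) (by fun_prop) ?_)
    intro y
    exact pow_ne_zero 2 (cosh_ne_zero_of_cos_pos (by simpa using hz₀))
  · refine ae_of_all _ fun y z hz => ?_
    have hcz : 0 < Real.cos z.im := hc0.trans hz.1
    have h1 := cosh_mul_cos_le_norm_cosh (z - y)
    have h2 := norm_sinh_le (z - y)
    simp only [Complex.sub_im, Complex.ofReal_im, sub_zero, Complex.sub_re, Complex.ofReal_re]
      at h1 h2
    set C := Real.cosh (z.re - y) with hC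
    have hCpos : 0 < C := Real.cosh_pos _
    have h3 : (C * c) ^ 2 ≤ ‖Complex.cosh (z - y)‖ ^ 2 := by
      have : C * c ≤ ‖Complex.cosh (z - y)‖ :=
        le_trans (mul_le_mul_of_nonneg_left hz.1.le hCpos.le) h1
      gcongr
    have h4 : C⁻¹ ≤ 2 * Real.exp (|z₀.re| + 1) * (Real.cosh y)⁻¹ := by
      refine (inv_cosh_sub_le z.re y).trans ?_
      have := Real.cosh_pos y
      have := hz.2.le
      gcongr
    rw [norm_mul, Complex.norm_real, norm_div, norm_neg, norm_pow]
    refine mul_le_mul (hM y) ?_ (by positivity) hM0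
    calc _ ≤ C / (C * c) ^ 2 := by gcongr
      _ = (c ^ 2)⁻¹ * C⁻¹ := by field_simp
      _ ≤ _ := by gcongr
  · exact ((integrable_inv_cosh.const_mul _).const_mul _).const_mul _
  · refine ae_of_all _ fun y z hz => ?_
    have hne : Complex.cosh (z - y) ≠ 0 :=
      cosh_ne_zero_of_cos_pos (by simpa using hc0.trans hz.1)
    have h := (((hasDerivAt_id z).sub_const (y : ℂ)).ccosh).inv hne
    simp only [id, mul_one] at h
    exact h.const_mul _

theorem norm_two_pi_inv : ‖(2 * Real.pi : ℂ)⁻¹‖ = (2 * Real.pi)⁻¹ := by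
  rw [norm_inv, norm_mul, Complex.norm_real, Real.norm_of_nonneg Real.pi_pos.le]
  simp

theorem norm_stripExt_le {g : ℝ → ℝ} {M : ℝ} (hM : ∀ x, |g x| ≤ M) {z : ℂ}
    (hz : 0 < Real.cos z.im) : ‖stripExt g z‖ ≤ M / 2 * (Real.cos z.im)⁻¹ := by
  have hb : Integrable fun u : ℝ => M * ((Real.cos z.im)⁻¹ * (Real.cosh u)⁻¹) :=
    (integrable_inv_cosh.const_mul _).const_mul _
  have h := norm_integral_le_of_norm_le hb (ae_of_all _ fun u : ℝ =>
    show ‖(g (z.re - u) : ℂ) * (Complex.cosh (u + z.im * I))⁻¹‖ ≤ _ by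
      rw [norm_mul, Complex.norm_real]
      have := norm_inv_cosh_le (u + z.im * I) (by simpa using hz)
      exact mul_le_mul (hM _) (by simpa using this) (norm_nonneg _)
        ((abs_nonneg _).trans (hM 0)))
  rw [integral_const_mul, integral_const_mul, integral_inv_cosh] at h
  rw [stripExt_eq_integral, norm_mul, norm_two_pi_inv]
  calc _ ≤ (2 * Real.pi)⁻¹ * (M * ((Real.cos z.im)⁻¹ * Real.pi)) := by gcongr
    _ = _ := by field_simp

/-- Convolution with `1 / (2π cosh)` has norm `1 / 2` on bounded functions. -/
theorem abs_sechConv_le {g : ℝ → ℝ} {M : ℝ} (hM : ∀ x, |g x| ≤ M) (x : ℝ) :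
    |sechConv g x| ≤ M / 2 := by
  have h := norm_stripExt_le hM (z := x) (by simp)
  rw [stripExt_ofReal, Complex.norm_real] at h
  simpa using h

theorem sechConv_sub {g g' : ℝ → ℝ} (hg : Continuous g) (hg' : Continuous g') {M M' : ℝ}
    (hM : ∀ x, |g x| ≤ M) (hM' : ∀ x, |g' x| ≤ M') (x : ℝ) :
    sechConv g x - sechConv g' x = sechConv (fun y => g y - g' y) x := by
  have h1 := integrable_mul_inv_cosh hg hM (z := x) (by simp)
  have h2 := integrable_mul_inv_cosh hg' hM' (z := x) (by simp)
  have h : stripExt g x - stripExt g' x = stripExt (fun y => g y - g' y) x := by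
    unfold stripExt
    rw [← mul_sub, ← integral_sub h1 h2]
    congr 2
    ext y
    push_cast
    ring
  simp only [stripExt_ofReal] at h
  exact_mod_cast h

theorem continuous_sechConv {g : ℝ → ℝ} (hg : Continuous g) {M : ℝ} (hM : ∀ x, |g x| ≤ M) :
    Continuous (sechConv g) := by
  have h : Continuous fun x : ℝ => stripExt g x :=
    continuous_iff_continuousAt.2 fun x =>
      (differentiableAt_stripExt hg hM (z₀ := x) (by simp)).continuousAt.comp
        Complex.continuous_ofReal.continuousAt
  refine (Complex.continuous_re.comp h).congr fun x => ?_
  simp [stripExt_ofReal]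

/-! ### Boundary behaviour for Lipschitz data -/

/-- The constant in the bound for the derivative of `stripExt g`, for `g` with Lipschitz constant
`1`. -/
noncomputable def derivConst : ℝ := (2 * Real.pi)⁻¹ * ∫ u, weight u

theorem derivConst_nonneg : 0 ≤ derivConst :=
  mul_nonneg (inv_nonneg.2 Real.two_pi_pos.le) (integral_nonneg weight_nonneg)

theorem ae_ne_zero : ∀ᵐ u : ℝ, u ≠ 0 := Measure.ae_ne volume 0

theorem norm_stripExt_add_sub_le {g : ℝ → ℝ} (hg : Continuous g) {M K : ℝ}
    (hM : ∀ x, |g x| ≤ M) (hK : ∀ x y, |g x - g y| ≤ K * |x - y|) {z : ℂ}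
    (hz : 0 < Real.cos z.im) (h : ℝ) :
    ‖stripExt g (z + h) - stripExt g z‖
      ≤ K * derivConst * (Real.sqrt (Real.cos z.im))⁻¹ * |h| := by
  have hK0 : 0 ≤ K := by
    have := (abs_nonneg _).trans (hK 1 0)
    simpa using this
  have hb : Integrable fun u : ℝ =>
      K * |h| * ((Real.sqrt (Real.cos z.im))⁻¹ * weight u) :=
    (integrable_weight.const_mul _).const_mul _
  rw [stripExt_eq_integral, stripExt_eq_integral, ← mul_sub]
  simp only [Complex.add_im, Complex.ofReal_im, add_zero, Complex.add_re, Complex.ofReal_re]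
  rw [← integral_sub (integrable_mul_inv_cosh' hg hM _ hz) (integrable_mul_inv_cosh' hg hM _ hz)]
  have hi := norm_integral_le_of_norm_le hb (f := fun u : ℝ =>
    (g (z.re + h - u) : ℂ) * (Complex.cosh (u + z.im * I))⁻¹
      - (g (z.re - u) : ℂ) * (Complex.cosh (u + z.im * I))⁻¹) <| by
      filter_upwards [ae_ne_zero] with u hu
      have h2 := inv_norm_cosh_le (u + z.im * I) (by simpa using hz) (by simpa using hu)
      simp only [Complex.add_im, Complex.ofReal_im, Complex.mul_im, Complex.ofReal_re,
        Complex.I_im, mul_one, Complex.I_re, mul_zero, add_zero, zero_add, Complex.add_re,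
        Complex.mul_re, sub_zero] at h2
      rw [← sub_mul, ← Complex.ofReal_sub, norm_mul, Complex.norm_real, norm_inv]
      refine mul_le_mul ?_ h2 (by positivity) (by positivity)
      have := hK (z.re + h - u) (z.re - u)
      rwa [show z.re + h - u - (z.re - u) = h by ring] at this
  rw [integral_const_mul, integral_const_mul] at hi
  rw [norm_mul, norm_two_pi_inv]
  calc _ ≤ (2 * Real.pi)⁻¹ * (K * |h| * ((Real.sqrt (Real.cos z.im))⁻¹ * ∫ u, weight u)) := by
        gcongr
    _ = _ := by unfold derivConst; ring

/-- As `stripExt g` is holomorphic, its derivative is bounded by the Lipschitz constant in the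
horizontal direction. -/
theorem norm_deriv_stripExt_le {g : ℝ → ℝ} (hg : Continuous g) {M K : ℝ}
    (hM : ∀ x, |g x| ≤ M) (hK : ∀ x y, |g x - g y| ≤ K * |x - y|) {z : ℂ}
    (hz : 0 < Real.cos z.im) :
    ‖deriv (stripExt g) z‖ ≤ K * derivConst * (Real.sqrt (Real.cos z.im))⁻¹ := by
  have hK0 : 0 ≤ K := by
    have := (abs_nonneg _).trans (hK 1 0)
    simpa using this
  have hd := (differentiableAt_stripExt hg hM hz).hasDerivAt
  rw [← add_zero z, ← Complex.ofReal_zero] at hd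
  have h1 : HasDerivAt (fun t : ℝ => stripExt g (z + t)) (deriv (stripExt g) (z + (0 : ℝ))) 0 :=
    (hd.comp_const_add z ((0 : ℝ) : ℂ)).comp_ofReal
  rw [Complex.ofReal_zero, add_zero] at h1
  have hC := derivConst_nonneg
  refine h1.le_of_lip' (by positivity) (Eventually.of_forall fun t => ?_)
  have := norm_stripExt_add_sub_le hg hM hK hz t
  simpa using this

theorem half_pi_sub_mul_le_cos {η : ℝ} (hη : |η| ≤ Real.pi / 2) :
    (2 / Real.pi) * (Real.pi / 2 - |η|) ≤ Real.cos η := by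
  have h := Real.one_sub_mul_le_cos (abs_nonneg η) hη
  rw [Real.cos_abs] at h
  refine le_trans (le_of_eq ?_) h
  have := Real.pi_pos
  field_simp

theorem inv_sqrt_cos_le {η : ℝ} (h1 : -(Real.pi / 2) < η) (h2 : η < Real.pi / 2) :
    (Real.sqrt (Real.cos η))⁻¹
      ≤ Real.sqrt (Real.pi / 2) * ((Real.sqrt (Real.pi / 2 + η))⁻¹
        + (Real.sqrt (Real.pi / 2 - η))⁻¹) := by
  have hη : |η| < Real.pi / 2 := abs_lt.2 ⟨h1, h2⟩
  have hp : 0 < Real.pi / 2 - |η| := by linarith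
  have hpi := Real.pi_pos
  have h3 : (Real.sqrt (Real.cos η))⁻¹
      ≤ Real.sqrt (Real.pi / 2) * (Real.sqrt (Real.pi / 2 - |η|))⁻¹ := by
    rw [← Real.sqrt_inv, ← Real.sqrt_inv, ← Real.sqrt_mul (by positivity)]
    refine Real.sqrt_le_sqrt ?_
    have := inv_anti₀ (by positivity) (half_pi_sub_mul_le_cos hη.le)
    rwa [mul_inv, inv_div] at this
  refine h3.trans (mul_le_mul_of_nonneg_left ?_ (by positivity))
  rcases abs_cases η with ⟨h, _⟩ | ⟨h, _⟩ <;> rw [h]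
  · exact le_add_of_nonneg_left (by positivity)
  · rw [sub_neg_eq_add]
    exact le_add_of_nonneg_right (by positivity)

/-- The constant in the vertical Hölder estimate for `stripExt g`, for `g` with Lipschitz constant
`1`. -/
noncomputable def holderConst : ℝ := 4 * derivConst * Real.sqrt (Real.pi / 2)

theorem holderConst_nonneg : 0 ≤ holderConst := by
  have := derivConst_nonneg
  unfold holderConst
  positivity

theorem sqrt_sub_sqrt_le {a b : ℝ} (ha : 0 ≤ a) (hab : a ≤ b) :
    Real.sqrt b - Real.sqrt a ≤ Real.sqrt (b - a) := by
  have hs := Real.sqrt_nonneg a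
  have hd := Real.sqrt_nonneg (b - a)
  rw [sub_le_iff_le_add, Real.sqrt_le_left (by positivity)]
  nlinarith [Real.sq_sqrt ha, Real.sq_sqrt (sub_nonneg.2 hab), mul_nonneg hs hd]

/-- The Hardy–Littlewood argument: a derivative which grows at most like the inverse square root of
the distance to the boundary forces Hölder continuity of exponent `1 / 2`, up to the boundary. -/
theorem norm_stripExt_vertical_sub_le {g : ℝ → ℝ} (hg : Continuous g) {M K : ℝ}
    (hM : ∀ x, |g x| ≤ M) (hK : ∀ x y, |g x - g y| ≤ K * |x - y|) (x : ℝ) {η η' : ℝ}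
    (h1 : -(Real.pi / 2) < η) (h2 : η ≤ η') (h3 : η' < Real.pi / 2) :
    ‖stripExt g (x + η' * I) - stripExt g (x + η * I)‖
      ≤ K * holderConst * Real.sqrt (η' - η) := by
  have hK0 : 0 ≤ K := by
    have := (abs_nonneg _).trans (hK 1 0)
    simpa using this
  have hC := derivConst_nonneg
  set L := K * derivConst * Real.sqrt (Real.pi / 2) with hL
  have hL0 : 0 ≤ L := by positivity
  set B : ℝ → ℝ := fun t => 2 * L * (Real.sqrt (Real.pi / 2 + t) - Real.sqrt (Real.pi / 2 - t)
    - (Real.sqrt (Real.pi / 2 + η) - Real.sqrt (Real.pi / 2 - η))) with hB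
  have hcos : ∀ t ∈ Icc η η', 0 < Real.cos t := fun t ht =>
    Real.cos_pos_of_mem_Ioo ⟨by linarith [ht.1], by linarith [ht.2]⟩
  -- `B` is the primitive of the bound of `inv_sqrt_cos_le`, normalised to vanish at `η`.
  have hf : ∀ t ∈ Icc η η', HasDerivAt
      (fun t : ℝ => stripExt g (x + t * I) - stripExt g (x + η * I))
      (deriv (stripExt g) (x + t * I) * I) t := by
    intro t ht
    have hd := (differentiableAt_stripExt hg hM (z₀ := x + t * I)
      (by simpa using hcos t ht)).hasDerivAt
    have hl : HasDerivAt (fun w : ℂ => x + w * I) I (t : ℂ) := by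
      simpa using ((hasDerivAt_id (t : ℂ)).mul_const I).const_add (x : ℂ)
    exact (hd.comp (t : ℂ) hl).comp_ofReal.sub_const _
  have hB' : ∀ t ∈ Icc η η', HasDerivAt B (L * ((Real.sqrt (Real.pi / 2 + t))⁻¹
      + (Real.sqrt (Real.pi / 2 - t))⁻¹)) t := by
    intro t ht
    have p1 : 0 < Real.pi / 2 + t := by linarith [ht.1]
    have p2 : 0 < Real.pi / 2 - t := by linarith [ht.2]
    have d1 := ((hasDerivAt_id t).const_add (Real.pi / 2)).sqrt p1.ne'
    have d2 := ((hasDerivAt_id t).const_sub (Real.pi / 2)).sqrt p2.ne'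
    have d := ((d1.sub d2).sub_const
      (Real.sqrt (Real.pi / 2 + η) - Real.sqrt (Real.pi / 2 - η))).const_mul (2 * L)
    have s1 := (Real.sqrt_pos.2 p1).ne'
    have s2 := (Real.sqrt_pos.2 p2).ne'
    refine d.congr_deriv ?_
    simp only [id]
    field_simp
    ring
  have hmain := image_norm_le_of_norm_deriv_right_le_deriv_boundary'
    (fun t ht => (hf t ht).continuousAt.continuousWithinAt)
    (fun t ht => (hf t (Ico_subset_Icc_self ht)).hasDerivWithinAt)
    (B := B) (by simp [hB]) (fun t ht => (hB' t ht).continuousAt.continuousWithinAt)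
    (fun t ht => (hB' t (Ico_subset_Icc_self ht)).hasDerivWithinAt)
    (fun t ht => by
      have ht' := Ico_subset_Icc_self ht
      have e := norm_deriv_stripExt_le hg hM hK (z := x + t * I) (by simpa using hcos t ht')
      have e2 := inv_sqrt_cos_le (η := t) (by linarith [ht'.1]) (by linarith [ht'.2])
      rw [norm_mul, Complex.norm_I, mul_one]
      refine e.trans ?_
      simp only [Complex.add_im, Complex.ofReal_im, Complex.mul_im, Complex.ofReal_re,
        Complex.I_im, mul_one, Complex.I_re, mul_zero, add_zero, zero_add]
      rw [hL, mul_assoc (K * derivConst)]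
      gcongr) (right_mem_Icc.2 h2)
  refine hmain.trans ?_
  have e1 := sqrt_sub_sqrt_le (a := Real.pi / 2 + η) (b := Real.pi / 2 + η') (by linarith)
    (by linarith)
  have e2 := sqrt_sub_sqrt_le (a := Real.pi / 2 - η') (b := Real.pi / 2 - η) (by linarith)
    (by linarith)
  rw [show Real.pi / 2 + η' - (Real.pi / 2 + η) = η' - η by ring] at e1
  rw [show Real.pi / 2 - η - (Real.pi / 2 - η') = η' - η by ring] at e2
  calc B η' ≤ 2 * L * (2 * Real.sqrt (η' - η)) := by
        rw [hB]
        refine mul_le_mul_of_nonneg_left ?_ (by positivity)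
        linarith
    _ = _ := by rw [hL, holderConst]; ring

/-- A quantitative form of the boundary equation: averaging `g (x - u) - g x`, which is at most
`K * |u|`, against the Poisson kernel gives a bound tending to zero as `cos η → 0`. -/
theorem norm_stripExt_add_conj_sub_le {g : ℝ → ℝ} (hg : Continuous g) {M K : ℝ}
    (hM : ∀ x, |g x| ≤ M) (hK : ∀ x y, |g x - g y| ≤ K * |x - y|) (x : ℝ) {η : ℝ}
    (hη : 0 < Real.cos η) :
    ‖stripExt g (x + η * I) + stripExt g (x - η * I) - g x‖
      ≤ 2 * K * derivConst * Real.sqrt (Real.cos η) := by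
  have hK0 : 0 ≤ K := by
    have := (abs_nonneg _).trans (hK 1 0)
    simpa using this
  have hη' : 0 < Real.cos (-η) := by rwa [Real.cos_neg]
  have hP := integrable_poisson η hη
  have hgx : (g x : ℂ) = (2 * Real.pi : ℂ)⁻¹ * ∫ u, (g x : ℂ) * (poisson η u : ℂ) := by
    rw [integral_const_mul, integral_complex_ofReal, integral_poisson η hη]
    have : (Real.pi : ℂ) ≠ 0 := by exact_mod_cast Real.pi_ne_zero
    push_cast
    field_simp
  have i1 := integrable_mul_inv_cosh' hg hM x hη
  have i2 := integrable_mul_inv_cosh' hg hM x hη'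
  have hrep : stripExt g (x + η * I) + stripExt g (x - η * I)
      = (2 * Real.pi : ℂ)⁻¹ * ∫ u : ℝ, (g (x - u) : ℂ) * (poisson η u : ℂ) := by
    rw [stripExt_eq_integral, stripExt_eq_integral, ← mul_add]
    simp only [Complex.add_im, Complex.ofReal_im, Complex.mul_im, Complex.ofReal_re,
      Complex.I_im, mul_one, Complex.I_re, mul_zero, add_zero, zero_add, Complex.add_re,
      Complex.mul_re, sub_zero, Complex.sub_re, Complex.sub_im, zero_sub]
    rw [← integral_add i1 i2]
    congr 2
    ext u
    rw [← mul_add, ← inv_cosh_add_inv_cosh η u hη]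
    push_cast
    rw [neg_mul, ← sub_eq_add_neg]
  have i3 : Integrable fun u : ℝ => (g (x - u) : ℂ) * (poisson η u : ℂ) := by
    refine (i1.add i2).congr (ae_of_all _ fun u => ?_)
    simp only [Pi.add_apply]
    rw [← mul_add, ← inv_cosh_add_inv_cosh η u hη]
    push_cast
    rw [neg_mul, ← sub_eq_add_neg]
  have i4 : Integrable fun u : ℝ => (g x : ℂ) * (poisson η u : ℂ) := hP.ofReal.const_mul _
  have hb : Integrable fun u : ℝ => K * (2 * Real.sqrt (Real.cos η) * weight u) :=
    (integrable_weight.const_mul _).const_mul _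
  have hi := norm_integral_le_of_norm_le hb (f := fun u : ℝ =>
    (g (x - u) : ℂ) * (poisson η u : ℂ) - (g x : ℂ) * (poisson η u : ℂ)) <| by
      filter_upwards [ae_ne_zero] with u hu
      rw [← sub_mul, ← Complex.ofReal_sub, norm_mul, Complex.norm_real, Complex.norm_real,
        Real.norm_of_nonneg (poisson_nonneg η u hη.le)]
      have e1 := hK (x - u) x
      rw [show x - u - x = -u by ring, abs_neg] at e1
      calc _ ≤ K * |u| * poisson η u :=
            mul_le_mul_of_nonneg_right e1 (poisson_nonneg η u hη.le)
        _ = K * (poisson η u * |u|) := by ring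
        _ ≤ _ := mul_le_mul_of_nonneg_left (poisson_mul_abs_le η u hη hu) hK0
  rw [hrep]
  conv_lhs => rw [hgx]
  rw [← mul_sub, ← integral_sub i3 i4, norm_mul, norm_two_pi_inv]
  rw [integral_const_mul, integral_const_mul] at hi
  calc _ ≤ (2 * Real.pi)⁻¹ * (K * (2 * Real.sqrt (Real.cos η) * ∫ u, weight u)) := by gcongr
    _ = _ := by unfold derivConst; ring

theorem norm_stripExt_vertical_sub_le_abs {g : ℝ → ℝ} (hg : Continuous g) {M K : ℝ}
    (hM : ∀ x, |g x| ≤ M) (hK : ∀ x y, |g x - g y| ≤ K * |x - y|) (x : ℝ) {η η' : ℝ}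
    (h : |η| < Real.pi / 2) (h' : |η'| < Real.pi / 2) :
    ‖stripExt g (x + η' * I) - stripExt g (x + η * I)‖
      ≤ K * holderConst * Real.sqrt |η' - η| := by
  rw [abs_lt] at h h'
  rcases le_total η η' with hle | hle
  · rw [abs_of_nonneg (sub_nonneg.2 hle)]
    exact norm_stripExt_vertical_sub_le hg hM hK x h.1 hle h'.2
  · rw [abs_of_nonpos (sub_nonpos.2 hle), norm_sub_rev, neg_sub]
    exact norm_stripExt_vertical_sub_le hg hM hK x h'.1 hle h.2

theorem isOpen_strip (s : ℝ) : IsOpen (strip s) :=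
  (isOpen_lt continuous_const Complex.continuous_im).inter
    (isOpen_lt Complex.continuous_im continuous_const)

theorem strip_eq_preimage (s : ℝ) : strip s = Complex.im ⁻¹' Ioo (-s) s := rfl

theorem mem_closure_strip {s : ℝ} (hs : 0 < s) {z : ℂ} :
    z ∈ closure (strip s) ↔ |z.im| ≤ s := by
  rw [strip_eq_preimage, Complex.closure_preimage_im, closure_Ioo (by linarith), mem_preimage,
    mem_Icc, abs_le]

theorem ofReal_mem_strip {s : ℝ} (hs : 0 < s) (x : ℝ) : (x : ℂ) ∈ strip s := by
  simp [strip, hs]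

theorem add_I_mul_mem_closure_strip {s : ℝ} (hs : 0 < s) (x : ℝ) :
    (x + I * s : ℂ) ∈ closure (strip s) := by
  rw [mem_closure_strip hs]; simp [abs_of_pos hs]

theorem sub_I_mul_mem_closure_strip {s : ℝ} (hs : 0 < s) (x : ℝ) :
    (x - I * s : ℂ) ∈ closure (strip s) := by
  rw [mem_closure_strip hs]; simp [abs_of_pos hs]

/-- For bounded Lipschitz `g`, the function `stripExt g` extends to a bounded function on the closed
strip, and its boundary values solve `F (x + iπ/2) + F (x - iπ/2) = g x`. The extension is the
uniform limit of the functions obtained by shrinking the imaginary part by a factor `Λ < 1`. -/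
theorem exists_mem_BA_boundary_sum {g : ℝ → ℝ} (hg : Continuous g) {M K : ℝ}
    (hM : ∀ x, |g x| ≤ M) (hK : ∀ x y, |g x - g y| ≤ K * |x - y|) :
    ∃ F ∈ BA (Real.pi / 2), (∀ x : ℝ, F x = sechConv g x) ∧
      ∀ x : ℝ, F (x + I * (Real.pi / 2 : ℝ)) + F (x - I * (Real.pi / 2 : ℝ)) = g x := by
  have hpi := Real.pi_pos
  have hs : 0 < Real.pi / 2 := by positivity
  have hK0 : 0 ≤ K := by
    have := (abs_nonneg _).trans (hK 1 0)
    simpa using this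
  have hH := holderConst_nonneg
  set Λ : ℕ → ℝ := fun n => 1 - 1 / ((n : ℝ) + 1) with hΛ
  have hΛ0 : ∀ n, 0 ≤ Λ n := fun n => by
    rw [hΛ, sub_nonneg, div_le_one (by positivity)]; linarith [Nat.cast_nonneg (α := ℝ) n]
  have hΛ1 : ∀ n, Λ n < 1 := fun n => by
    have : 0 < 1 / ((n : ℝ) + 1) := by positivity
    simp only [hΛ]; linarith
  have hΛmono : ∀ n m, n ≤ m → Λ n ≤ Λ m := fun n m hnm => by
    have : 1 / ((m : ℝ) + 1) ≤ 1 / ((n : ℝ) + 1) := by gcongr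
    simp only [hΛ]; linarith
  have hΛlim : Tendsto Λ atTop (𝓝 1) := by
    have := (tendsto_one_div_add_atTop_nhds_zero_nat (𝕜 := ℝ)).const_sub 1
    rwa [sub_zero] at this
  set Φ : ℕ → ℂ → ℂ := fun n z => stripExt g (z.re + (Λ n * z.im : ℝ) * I) with hΦ
  have him : ∀ n, ∀ z ∈ closure (strip (Real.pi / 2)), |Λ n * z.im| < Real.pi / 2 := by
    intro n z hz
    rw [mem_closure_strip hs] at hz
    rw [abs_mul, abs_of_nonneg (hΛ0 n)]
    calc Λ n * |z.im| ≤ Λ n * (Real.pi / 2) := mul_le_mul_of_nonneg_left hz (hΛ0 n)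
      _ < 1 * (Real.pi / 2) := mul_lt_mul_of_pos_right (hΛ1 n) hs
      _ = _ := one_mul _
  have hcos : ∀ n, ∀ z ∈ closure (strip (Real.pi / 2)), 0 < Real.cos (Λ n * z.im) :=
    fun n z hz => Real.cos_pos_of_mem_Ioo (abs_lt.1 (him n z hz))
  set b : ℕ → ℝ := fun n => K * holderConst * Real.sqrt ((1 - Λ n) * (Real.pi / 2)) with hb
  have hblim : Tendsto b atTop (𝓝 0) := by
    have h1 := ((hΛlim.const_sub 1).mul_const (Real.pi / 2)).sqrt.const_mul (K * holderConst)
    simpa using h1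
  have hcauchy : ∀ z ∈ closure (strip (Real.pi / 2)), ∀ n m, n ≤ m →
      dist (Φ n z) (Φ m z) ≤ b n := by
    intro z hz n m hnm
    rw [dist_comm, dist_eq_norm]
    refine (norm_stripExt_vertical_sub_le_abs hg hM hK z.re (him n z hz) (him m z hz)).trans ?_
    refine mul_le_mul_of_nonneg_left (Real.sqrt_le_sqrt ?_) (by positivity)
    rw [mem_closure_strip hs] at hz
    rw [← sub_mul, abs_mul, abs_of_nonneg (sub_nonneg.2 (hΛmono n m hnm))]
    have h1 := hΛ1 m
    have h2 := hΛ1 n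
    exact mul_le_mul (by linarith) hz (abs_nonneg _) (by linarith)
  have hex : ∀ z, ∃ w, z ∈ closure (strip (Real.pi / 2)) →
      Tendsto (fun n => Φ n z) atTop (𝓝 w) := by
    intro z
    by_cases hz : z ∈ closure (strip (Real.pi / 2))
    · obtain ⟨w, hw⟩ := cauchySeq_tendsto_of_complete
        (cauchySeq_of_le_tendsto_0' b (hcauchy z hz) hblim)
      exact ⟨w, fun _ => hw⟩
    · exact ⟨0, fun h => absurd h hz⟩
  choose F hF using hex
  have hdist : ∀ n, ∀ z ∈ closure (strip (Real.pi / 2)), dist (F z) (Φ n z) ≤ b n := by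
    intro n z hz
    refine le_of_tendsto ((hF z hz).dist tendsto_const_nhds) ?_
    filter_upwards [eventually_ge_atTop n] with m hm
    rw [dist_comm]
    exact hcauchy z hz n m hm
  have hunif : TendstoUniformlyOn Φ F atTop (closure (strip (Real.pi / 2))) := by
    rw [Metric.tendstoUniformlyOn_iff]
    intro ε hε
    filter_upwards [hblim.eventually (gt_mem_nhds hε)] with n hn z hz
    exact (hdist n z hz).trans_lt hn
  have hΦcont : ∀ n, ContinuousOn (Φ n) (closure (strip (Real.pi / 2))) := by
    intro n z hz
    have hd := (differentiableAt_stripExt hg hM (z₀ := z.re + (Λ n * z.im : ℝ) * I)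
      (by simpa using hcos n z hz)).continuousAt
    have hc : Continuous fun w : ℂ => (w.re : ℂ) + (Λ n * w.im : ℝ) * I := by fun_prop
    exact (ContinuousAt.comp (f := fun w : ℂ => (w.re : ℂ) + (Λ n * w.im : ℝ) * I) hd
      hc.continuousAt).continuousWithinAt
  have hFeq : ∀ z ∈ strip (Real.pi / 2), F z = stripExt g z := by
    intro z hz
    refine tendsto_nhds_unique (hF z (subset_closure hz)) ?_
    have hd := (differentiableAt_stripExt hg hM (cos_im_pos_of_mem_strip hz)).continuousAt
    refine hd.tendsto.comp ?_
    have h1 : Tendsto (fun n => (z.re : ℂ) + (Λ n * z.im : ℝ) * I) atTop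
        (𝓝 ((z.re : ℂ) + (1 * z.im : ℝ) * I)) := by
      refine Tendsto.const_add _ (Tendsto.mul_const _ ?_)
      exact (Complex.continuous_ofReal.tendsto _).comp (hΛlim.mul_const _)
    rwa [one_mul, Complex.re_add_im] at h1
  refine ⟨F, ⟨⟨?_, ?_⟩, M / 2 + b 0, ?_⟩, ?_, ?_⟩
  · refine DifferentiableOn.congr (f := stripExt g) (fun z hz => ?_) hFeq
    exact (differentiableAt_stripExt hg hM
      (cos_im_pos_of_mem_strip hz)).differentiableWithinAt
  · exact hunif.continuousOn (Frequently.of_forall hΦcont)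
  · intro z hz
    have h1 := hdist 0 z hz
    have h2 : ‖Φ 0 z‖ ≤ M / 2 := by
      have := norm_stripExt_le hM (z := z.re) (by simp)
      simpa [hΦ, hΛ] using this
    rw [dist_eq_norm] at h1
    have h3 := norm_le_norm_sub_add (F z) (Φ 0 z)
    linarith
  · intro x
    rw [hFeq x (ofReal_mem_strip hs x), stripExt_ofReal]
  · intro x
    have h1 := hF _ (add_I_mul_mem_closure_strip hs x)
    have h2 := hF _ (sub_I_mul_mem_closure_strip hs x)
    have h3 : Tendsto (fun n => 2 * K * derivConst * Real.sqrt (Real.cos (Λ n * (Real.pi / 2))))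
        atTop (𝓝 0) := by
      have := ((Real.continuous_cos.tendsto _).comp
        (hΛlim.mul_const (Real.pi / 2))).sqrt.const_mul (2 * K * derivConst)
      simpa using this
    refine tendsto_nhds_unique (h1.add h2) ?_
    rw [tendsto_iff_norm_sub_tendsto_zero]
    refine squeeze_zero (fun n => norm_nonneg _) (fun n => ?_) h3
    have h4 := hcos n _ (add_I_mul_mem_closure_strip hs x)
    have e1 : (x + I * (Real.pi / 2 : ℝ) : ℂ).im = Real.pi / 2 := by simp
    rw [e1] at h4
    have h5 := norm_stripExt_add_conj_sub_le hg hM hK x h4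
    refine le_trans (le_of_eq ?_) h5
    congr 2
    have e2 : (x - I * (Real.pi / 2 : ℝ) : ℂ).im = -(Real.pi / 2) := by simp
    have e3 : (x + I * (Real.pi / 2 : ℝ) : ℂ).re = x := by simp
    have e4 : (x - I * (Real.pi / 2 : ℝ) : ℂ).re = x := by simp
    simp only [hΦ, e1, e2, e3, e4]
    congr 2
    push_cast
    ring

/-- Cauchy's estimate on discs of radius `1 < π / 2`. -/
theorem norm_sub_le_of_bounded_on_strip {f : ℂ → ℂ}
    (hf : DifferentiableOn ℂ f (strip (Real.pi / 2))) {C : ℝ}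
    (hC : ∀ z : ℂ, |z.im| ≤ 1 → ‖f z‖ ≤ C) (x y : ℝ) : ‖f x - f y‖ ≤ C * |x - y| := by
  have hball : ∀ z : ℂ, z.im = 0 → ∀ w ∈ Metric.closedBall z 1, |w.im| ≤ 1 := by
    intro z hz w hw
    have h := Complex.abs_im_le_norm (w - z)
    rw [Complex.sub_im, hz, sub_zero] at h
    exact h.trans (by simpa [dist_eq_norm] using hw)
  have hmem : ∀ w : ℂ, |w.im| ≤ 1 → w ∈ strip (Real.pi / 2) := by
    intro w hw
    have := Real.pi_gt_three
    rw [abs_le] at hw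
    exact ⟨by linarith, by linarith⟩
  have hconv : Convex ℝ {z : ℂ | z.im = 0} :=
    (convex_singleton (0 : ℝ)).linear_preimage Complex.imLm
  have h := hconv.norm_image_sub_le_of_norm_deriv_le (𝕜 := ℂ) (f := f) (C := C) (x := y) (y := x)
    (fun z hz => hf.differentiableAt ((isOpen_strip _).mem_nhds (hmem z (by
      rw [show z.im = 0 from hz]; simp))))
    (fun z hz => ?_) (by simp) (by simp)
  · rwa [← Complex.ofReal_sub, Complex.norm_real] at h
  · have h1 := Complex.norm_deriv_le_of_forall_mem_sphere_norm_le (c := z) (R := 1) (C := C)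
      (f := f) one_pos (hf.diffContOnCl_ball fun w hw => hmem w (hball z hz w hw))
      (fun w hw => hC w (hball z hz w (Metric.sphere_subset_closedBall hw)))
    simpa using h1

theorem abs_sechConv_sub_le {g : ℝ → ℝ} (hg : Continuous g) {M : ℝ} (hM : ∀ x, |g x| ≤ M)
    (x y : ℝ) : |sechConv g x - sechConv g y| ≤ M / 2 * (Real.cos 1)⁻¹ * |x - y| := by
  have hM0 : 0 ≤ M := (abs_nonneg _).trans (hM 0)
  have h := norm_sub_le_of_bounded_on_strip (f := stripExt g)
    (C := M / 2 * (Real.cos 1)⁻¹) (fun z hz => (differentiableAt_stripExt hg hM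
      (cos_im_pos_of_mem_strip hz)).differentiableWithinAt) (fun z hz => ?_) x y
  · rw [stripExt_ofReal, stripExt_ofReal, ← Complex.ofReal_sub, Complex.norm_real] at h
    exact h
  · have h1 := Real.cos_one_pos
    have h2 : Real.cos 1 ≤ Real.cos z.im := by
      rw [← Real.cos_abs z.im]
      exact Real.cos_le_cos_of_nonneg_of_le_pi (abs_nonneg _) (by linarith [Real.pi_gt_three]) hz
    refine (norm_stripExt_le hM (h1.trans_le h2)).trans ?_
    gcongr

/-! ### Uniqueness of bounded solutions of the linear boundary equation -/

/-- The maximum principle for the real part, from Phragmén–Lindelöf applied to `exp ∘ f`. -/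
theorem re_nonpos_of_re_boundary {s : ℝ} (hs : 0 < s) {f : ℂ → ℂ} (hf : f ∈ BA s)
    (hb : ∀ z : ℂ, |z.im| = s → (f z).re ≤ 0) {z : ℂ} (hz : z ∈ closure (strip s)) :
    (f z).re ≤ 0 := by
  obtain ⟨hfA, C, hC⟩ := hf
  have hd : DiffContOnCl ℂ (fun w => Complex.exp (f w)) (strip s) :=
    Complex.differentiable_exp.comp_diffContOnCl hfA
  have hz' := (mem_closure_strip hs).1 hz
  rw [abs_le] at hz'
  have hbd : ∀ w : ℂ, |w.im| = s → ‖Complex.exp (f w)‖ ≤ 1 := fun w hw => by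
    rw [Complex.norm_exp, Real.exp_le_one_iff]
    exact hb w hw
  have h := PhragmenLindelof.horizontal_strip (a := -s) (b := s) (C := 1)
    (f := fun w => Complex.exp (f w)) hd
    ⟨0, by have := Real.pi_pos; apply div_pos <;> linarith, 0, ?_⟩
    (fun w hw => hbd w (by rw [hw, abs_neg, abs_of_pos hs]))
    (fun w hw => hbd w (by rw [hw, abs_of_pos hs])) hz'.1 hz'.2
  · rwa [Complex.norm_exp, Real.exp_le_one_iff] at h
  · refine Asymptotics.IsBigO.of_bound (Real.exp C) ?_
    refine Filter.mem_inf_of_right ?_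
    intro w hw
    have h1 := (Complex.re_le_norm _).trans (hC w (subset_closure hw))
    simpa [Complex.norm_exp] using h1

theorem re_eq_zero_of_boundary_antisymm {s : ℝ} (hs : 0 < s) {f : ℂ → ℂ} (hf : f ∈ BA s)
    (hb : ∀ x : ℝ, f (x + I * s) + f (x - I * s) = 0) (x : ℝ) : (f x).re = 0 := by
  obtain ⟨hfA, C, hC⟩ := hf
  -- On the boundary, `k = f + conj ∘ f ∘ conj` is purely imaginary; on the real line it is
  -- `2 Re f`.
  set k : ℂ → ℂ := fun z => f z + (starRingEnd ℂ) (f ((starRingEnd ℂ) z)) with hk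
  have hconj : ∀ z ∈ closure (strip s), (starRingEnd ℂ) z ∈ closure (strip s) := fun z hz => by
    rw [mem_closure_strip hs] at hz ⊢; simpa using hz
  have hconj' : ∀ z ∈ strip s, (starRingEnd ℂ) z ∈ strip s := fun z hz => by
    refine ⟨?_, ?_⟩ <;> simp only [Complex.conj_im] <;> linarith [hz.1, hz.2]
  have hkA : k ∈ BA s := by
    refine ⟨⟨fun z hz => ?_, ?_⟩, C + C, fun z hz => ?_⟩
    · have h1 := hfA.differentiableAt (isOpen_strip s) hz
      have h2 := (hfA.differentiableAt (isOpen_strip s) (hconj' z hz)).conj_conj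
      rw [Complex.conj_conj] at h2
      exact (h1.add h2).differentiableWithinAt
    · refine hfA.continuousOn.add ?_
      exact Complex.continuous_conj.comp_continuousOn
        (hfA.continuousOn.comp Complex.continuous_conj.continuousOn hconj)
    · refine (norm_add_le _ _).trans (add_le_add (hC z hz) ?_)
      rw [Complex.norm_conj]
      exact hC _ (hconj z hz)
  have hkb : ∀ z : ℂ, |z.im| = s → (k z).re = 0 := by
    intro z hz
    have h := hb z.re
    have key : f z + f ((starRingEnd ℂ) z) = 0 := by
      rcases (abs_eq hs.le).1 hz with h1 | h1
      · have e1 : (z.re + I * s : ℂ) = z := by apply Complex.ext <;> simp [h1]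
        have e2 : (z.re - I * s : ℂ) = (starRingEnd ℂ) z := by apply Complex.ext <;> simp [h1]
        rwa [e1, e2] at h
      · have e1 : (z.re - I * s : ℂ) = z := by apply Complex.ext <;> simp [h1]
        have e2 : (z.re + I * s : ℂ) = (starRingEnd ℂ) z := by apply Complex.ext <;> simp [h1]
        rwa [e1, e2, add_comm] at h
    have h2 := congrArg Complex.re key
    simpa [hk] using h2
  have hneg : (fun z => -k z) ∈ BA s := by
    obtain ⟨h1, D, hD⟩ := hkA
    exact ⟨DiffContOnCl.neg h1, D, fun z hz => by rw [norm_neg]; exact hD z hz⟩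
  have hx : (x : ℂ) ∈ closure (strip s) := subset_closure (ofReal_mem_strip hs x)
  have h1 := re_nonpos_of_re_boundary hs hkA (fun z hz => (hkb z hz).le) hx
  have h2 := re_nonpos_of_re_boundary hs hneg (fun z hz => by simp [hkb z hz]) hx
  simp only [hk, Complex.add_re, Complex.conj_ofReal, Complex.conj_re, Complex.neg_re] at h1 h2
  linarith

theorem eq_zero_of_boundary_antisymm {s : ℝ} (hs : 0 < s) {f : ℂ → ℂ} (hf : f ∈ BA s)
    (hb : ∀ x : ℝ, f (x + I * s) + f (x - I * s) = 0) (x : ℝ) : f x = 0 := by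
  apply Complex.ext
  · exact re_eq_zero_of_boundary_antisymm hs hf hb x
  · obtain ⟨hfA, C, hC⟩ := hf
    have h := re_eq_zero_of_boundary_antisymm hs (f := fun z => I • f z)
      ⟨DiffContOnCl.const_smul hfA I, C, fun z hz => by
        rw [norm_smul, Complex.norm_I, one_mul]; exact hC z hz⟩
      (fun y => by rw [← smul_add, hb y, smul_zero]) x
    simpa using h

theorem eqOn_closure_strip_of_eq_on_real {s : ℝ} (hs : 0 < s) {f g : ℂ → ℂ} (hf : f ∈ A s)
    (hg : g ∈ A s) (h : ∀ x : ℝ, f x = g x) : EqOn f g (closure (strip s)) := by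
  have hU : IsPreconnected (strip s) := by
    rw [strip_eq_preimage]
    exact ((convex_Ioo (-s) s).linear_preimage Complex.imLm).isPreconnected
  have h0 : (0 : ℂ) ∈ strip s := by simpa using ofReal_mem_strip hs 0
  have hfr : ∃ᶠ z in 𝓝[≠] (0 : ℂ), f z = g z := by
    have ht : Tendsto (fun n : ℕ => ((1 / ((n : ℝ) + 1) : ℝ) : ℂ)) atTop (𝓝[≠] (0 : ℂ)) := by
      refine tendsto_nhdsWithin_iff.2 ⟨?_, Eventually.of_forall fun n => ?_⟩
      · have := (Complex.continuous_ofReal.tendsto _).comp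
          (tendsto_one_div_add_atTop_nhds_zero_nat (𝕜 := ℝ))
        rwa [Complex.ofReal_zero] at this
      · have : (1 / ((n : ℝ) + 1) : ℝ) ≠ 0 := by positivity
        simpa using Nat.cast_add_one_ne_zero n
    exact ht.frequently (Frequently.of_forall fun n => h _)
  have heq : EqOn f g (strip s) :=
    (hf.differentiableOn.analyticOnNhd (isOpen_strip s)).eqOn_of_preconnected_of_frequently_eq
      (hg.differentiableOn.analyticOnNhd (isOpen_strip s)) hU h0 hfr
  exact heq.of_subset_closure hf.continuousOn hg.continuousOn subset_closure le_rfl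

/-! ### The matrix `G / 2` and its powers -/

/-- The matrix `G / 2` is diagonalisable with eigenvalues in `(-1, 1)`. -/
theorem tendsto_half_pow {N : ℕ} {G : Matrix (Fin N) (Fin N) ℝ} (hG : G ∈ MatLT2 N)
    (i j : Fin N) : Tendsto (fun k : ℕ => (((1 / 2 : ℝ) • G) ^ k) i j) atTop (𝓝 0) := by
  obtain ⟨⟨P, d, hP, hGP⟩, hev⟩ := hG
  have hdet : IsUnit P.det := (Matrix.isUnit_iff_isUnit_det P).1 hP
  have hinv : P⁻¹ * P = 1 := Matrix.nonsing_inv_mul P hdet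
  have hinv' : P * P⁻¹ = 1 := Matrix.mul_nonsing_inv P hdet
  have hd : ∀ l, -2 < d l ∧ d l < 2 := by
    intro l
    refine hev (d l) (Module.End.hasEigenvalue_of_hasEigenvector
      (x := P.mulVec (Pi.single l 1)) ⟨?_, ?_⟩)
    · rw [Module.End.mem_eigenspace_iff, Matrix.toLin'_apply, Matrix.mulVec_mulVec, hGP,
        Matrix.mul_assoc, hinv, Matrix.mul_one, ← Matrix.mulVec_mulVec, ← Matrix.mulVec_smul]
      congr 1
      ext m
      rw [Matrix.mulVec_diagonal]
      by_cases hm : m = l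
      · subst hm; simp
      · simp [hm]
    · intro h0
      have h1 := congrArg P⁻¹.mulVec h0
      rw [Matrix.mulVec_mulVec, hinv, Matrix.one_mulVec, Matrix.mulVec_zero] at h1
      have := congrFun h1 l
      simp at this
  have hpow : ∀ k : ℕ, ((1 / 2 : ℝ) • G) ^ k
      = P * Matrix.diagonal (fun l => (d l / 2) ^ k) * P⁻¹ := by
    intro k
    induction k with
    | zero => simp [hinv']
    | succ k ih =>
      have e : (1 / 2 : ℝ) • G = P * Matrix.diagonal (fun l => d l / 2) * P⁻¹ := by
        rw [hGP, ← Matrix.smul_mul, ← Matrix.mul_smul, ← Matrix.diagonal_smul]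
        congr 3
        ext l
        simp only [Pi.smul_apply, smul_eq_mul]
        ring
      rw [pow_succ, ih, e]
      calc _ = P * Matrix.diagonal (fun l => (d l / 2) ^ k) * (P⁻¹ * P)
              * Matrix.diagonal (fun l => d l / 2) * P⁻¹ := by simp only [Matrix.mul_assoc]
        _ = _ := by
          rw [hinv, Matrix.mul_one, Matrix.mul_assoc P, Matrix.diagonal_mul_diagonal]
          simp only [pow_succ]
  have hentry : ∀ k : ℕ, (((1 / 2 : ℝ) • G) ^ k) i j
      = ∑ l, P i l * (d l / 2) ^ k * P⁻¹ l j := by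
    intro k
    rw [hpow, Matrix.mul_apply]
    simp only [Matrix.mul_diagonal]
  simp only [hentry]
  rw [show (0 : ℝ) = ∑ l, P i l * 0 * P⁻¹ l j by simp]
  refine tendsto_finsetSum _ fun l _ => Tendsto.mul_const _ (Tendsto.const_mul _ ?_)
  refine tendsto_pow_atTop_nhds_zero_of_abs_lt_one ?_
  rw [abs_lt]
  constructor <;> linarith [(hd l).1, (hd l).2]

/-- A vector-valued form of the contraction principle: `T` contracts the vector of componentwise
distances by a non-negative matrix whose powers tend to zero. -/
theorem existsUnique_fixedPoint_of_matrix_bound {N : ℕ} {E : Type*} [MetricSpace E]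
    [CompleteSpace E] [Nonempty E] {B : Matrix (Fin N) (Fin N) ℝ} (hB : ∀ i j, 0 ≤ B i j)
    (hlim : ∀ i j, Tendsto (fun k : ℕ => (B ^ k) i j) atTop (𝓝 0))
    {T : (Fin N → E) → Fin N → E}
    (hT : ∀ f g n, dist (T f n) (T g n) ≤ ∑ m, B n m * dist (f m) (g m)) :
    ∃! f, T f = f := by
  have hiter : ∀ (k : ℕ) (f g : Fin N → E) (n : Fin N),
      dist (T^[k] f n) (T^[k] g n) ≤ ∑ m, (B ^ k) n m * dist (f m) (g m) := by
    intro k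
    induction k with
    | zero => intro f g n; simp [Matrix.one_apply]
    | succ k ih =>
      intro f g n
      rw [Function.iterate_succ_apply', Function.iterate_succ_apply']
      calc _ ≤ ∑ l, B n l * dist (T^[k] f l) (T^[k] g l) := hT _ _ _
        _ ≤ ∑ l, B n l * ∑ m, (B ^ k) l m * dist (f m) (g m) :=
            Finset.sum_le_sum fun l _ => mul_le_mul_of_nonneg_left (ih f g l) (hB n l)
        _ = _ := by
            simp only [pow_succ', Matrix.mul_apply, Finset.sum_mul, Finset.mul_sum]
            rw [Finset.sum_comm]
            simp only [mul_assoc]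
  have hBk : ∀ (k : ℕ) i j, 0 ≤ (B ^ k) i j := by
    intro k
    induction k with
    | zero => intro i j; rw [pow_zero, Matrix.one_apply]; split_ifs <;> norm_num
    | succ k ih =>
      intro i j
      rw [pow_succ, Matrix.mul_apply]
      exact Finset.sum_nonneg fun l _ => mul_nonneg (ih i l) (hB l j)
  have hsum : ∀ n, ∀ᶠ k : ℕ in atTop, ∑ m, (B ^ k) n m < 1 / 2 := by
    intro n
    have h : Tendsto (fun k : ℕ => ∑ m, (B ^ k) n m) atTop (𝓝 (∑ _m : Fin N, 0)) :=
      tendsto_finsetSum _ fun m _ => hlim n m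
    rw [Finset.sum_const_zero] at h
    exact h.eventually (gt_mem_nhds (by norm_num))
  obtain ⟨k, hk⟩ := (eventually_all.2 hsum).exists
  have hcontr : ContractingWith (1 / 2) T^[k] := by
    refine ⟨by norm_num, LipschitzWith.of_dist_le_mul fun f g => ?_⟩
    refine (dist_pi_le_iff (by positivity)).2 fun n => (hiter k f g n).trans ?_
    calc _ ≤ ∑ m, (B ^ k) n m * dist f g :=
          Finset.sum_le_sum fun m _ => mul_le_mul_of_nonneg_left (dist_le_pi_dist f g m) (hBk k n m)
      _ = (∑ m, (B ^ k) n m) * dist f g := by rw [Finset.sum_mul]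
      _ ≤ _ := by
          refine mul_le_mul_of_nonneg_right ?_ dist_nonneg
          simpa using (hk n).le
  refine ⟨_, hcontr.isFixedPt_fixedPoint_iterate, fun g hg => ?_⟩
  exact hcontr.fixedPoint_unique (Function.IsFixedPt.iterate hg k)

/-! ### The nonlinear integral equation on the real line -/

/-- The nonlinearity `log (1 + e ^ (α + r)) - α`, written so that it depends on `α` only through
`e ^ (-α)`. -/
noncomputable def logShift (α r : ℝ) : ℝ := Real.log (Real.exp (-α) + Real.exp r)

theorem exp_logShift (α r : ℝ) : Real.exp (logShift α r) = Real.exp (-α) + Real.exp r :=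
  Real.exp_log (by positivity)

theorem exp_logShift_add (α r : ℝ) : Real.exp (logShift α r + α) = 1 + Real.exp (r + α) := by
  rw [Real.exp_add, exp_logShift, add_mul, ← Real.exp_add, ← Real.exp_add, neg_add_cancel,
    Real.exp_zero]

theorem le_logShift (α r : ℝ) : r ≤ logShift α r := by
  rw [← Real.exp_le_exp, exp_logShift]
  linarith [Real.exp_pos (-α)]

theorem logShift_le_add {α r r' : ℝ} (h : r ≤ r') : logShift α r' ≤ logShift α r + (r' - r) := by
  rw [← Real.exp_le_exp, Real.exp_add, exp_logShift, exp_logShift, add_mul, ← Real.exp_add r,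
    add_sub_cancel]
  have h1 : 1 ≤ Real.exp (r' - r) := Real.one_le_exp (sub_nonneg.2 h)
  have h2 := Real.exp_pos (-α)
  nlinarith

theorem logShift_mono {α r r' : ℝ} (h : r ≤ r') : logShift α r ≤ logShift α r' := by
  rw [← Real.exp_le_exp, exp_logShift, exp_logShift]
  have := Real.exp_le_exp.2 h
  linarith

theorem abs_logShift_sub_le (α r r' : ℝ) : |logShift α r - logShift α r'| ≤ |r - r'| := by
  rcases le_total r r' with h | h
  · have h1 := logShift_le_add (α := α) h
    have h2 := logShift_mono (α := α) h
    rw [abs_sub_comm, abs_sub_comm r, abs_of_nonneg (sub_nonneg.2 h2),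
      abs_of_nonneg (sub_nonneg.2 h)]
    linarith
  · have h1 := logShift_le_add (α := α) h
    have h2 := logShift_mono (α := α) h
    rw [abs_of_nonneg (sub_nonneg.2 h2), abs_of_nonneg (sub_nonneg.2 h)]
    linarith

theorem logShift_sub_le {α α' r M : ℝ} (hr : -M ≤ r) :
    logShift α r - logShift α' r ≤ Real.exp M * |Real.exp (-α) - Real.exp (-α')| := by
  have p1 : 0 < Real.exp (-α) + Real.exp r := by positivity
  have p2 : 0 < Real.exp (-α') + Real.exp r := by positivity
  unfold logShift
  rw [← Real.log_div p1.ne' p2.ne']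
  refine (Real.log_le_sub_one_of_pos (div_pos p1 p2)).trans ?_
  have e : (Real.exp (-α) + Real.exp r) / (Real.exp (-α') + Real.exp r) - 1
      = (Real.exp (-α') + Real.exp r)⁻¹ * (Real.exp (-α) - Real.exp (-α')) := by
    field_simp
    ring
  rw [e]
  have h1 : (Real.exp (-α') + Real.exp r)⁻¹ ≤ Real.exp M := by
    rw [inv_le_comm₀ p2 (Real.exp_pos M), ← Real.exp_neg]
    have := Real.exp_le_exp.2 hr
    linarith [Real.exp_pos (-α')]
  exact (mul_le_mul_of_nonneg_left (le_abs_self _) (by positivity)).trans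
    (mul_le_mul_of_nonneg_right h1 (abs_nonneg _))

theorem abs_logShift_sub_le_of_le {α α' r r' M : ℝ} (hr' : -M ≤ r') :
    |logShift α r - logShift α' r'|
      ≤ |r - r'| + Real.exp M * |Real.exp (-α) - Real.exp (-α')| := by
  have h1 := abs_logShift_sub_le α r r'
  have h2 : |logShift α r' - logShift α' r'|
      ≤ Real.exp M * |Real.exp (-α) - Real.exp (-α')| := by
    rw [abs_le']
    refine ⟨logShift_sub_le hr', ?_⟩
    rw [neg_sub, abs_sub_comm]
    exact logShift_sub_le hr'
  exact (abs_sub_le _ (logShift α r') _).trans (add_le_add h1 h2)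

theorem abs_logShift_le {α r C M : ℝ} (hα : Real.exp (-α) ≤ C) (hr : |r| ≤ M) :
    |logShift α r| ≤ M + C := by
  have hC : 0 ≤ C := (Real.exp_pos _).le.trans hα
  rw [abs_le] at hr ⊢
  refine ⟨by linarith [le_logShift α r, hr.1], ?_⟩
  rw [← Real.exp_le_exp, exp_logShift, Real.exp_add]
  have h1 := Real.exp_le_exp.2 hr.2
  have h2 := Real.add_one_le_exp C
  have h3 : 1 ≤ Real.exp M := Real.one_le_exp (by linarith [hr.1, hr.2])
  nlinarith

/-- The right-hand side of the boundary equation for `log Y - a`. -/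
noncomputable def source {N : ℕ} (G : Matrix (Fin N) (Fin N) ℝ) (α r : Fin N → ℝ → ℝ)
    (n : Fin N) (x : ℝ) : ℝ :=
  ∑ m, G n m * logShift (α m x) (r m x)

theorem continuous_source {N : ℕ} (G : Matrix (Fin N) (Fin N) ℝ) {α r : Fin N → ℝ → ℝ}
    (hα : ∀ m, Continuous (α m)) (hr : ∀ m, Continuous (r m)) (n : Fin N) :
    Continuous (source G α r n) := by
  refine continuous_finsetSum _ fun m _ => Continuous.mul continuous_const ?_
  refine Continuous.log ?_ fun x => ?_
  · exact (Real.continuous_exp.comp (hα m).neg).add (Real.continuous_exp.comp (hr m))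
  · positivity

theorem exists_abs_source_le {N : ℕ} {G : Matrix (Fin N) (Fin N) ℝ} (hG : IsNonneg G)
    {α r : Fin N → ℝ → ℝ} (hα : ∀ m, ∃ C, ∀ x, Real.exp (-α m x) ≤ C)
    (hr : ∀ m, ∃ M, ∀ x, |r m x| ≤ M) (n : Fin N) : ∃ M, ∀ x, |source G α r n x| ≤ M := by
  choose C hC using hα
  choose M hM using hr
  refine ⟨∑ m, G n m * (M m + C m), fun x => (Finset.abs_sum_le_sum_abs _ _).trans ?_⟩
  refine Finset.sum_le_sum fun m _ => ?_
  rw [abs_mul, abs_of_nonneg (hG n m)]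
  exact mul_le_mul_of_nonneg_left (abs_logShift_le (hC m x) (hM m x)) (hG n m)

theorem exists_lipschitz_source {N : ℕ} {G : Matrix (Fin N) (Fin N) ℝ} (hG : IsNonneg G)
    {α r : Fin N → ℝ → ℝ}
    (hα : ∀ m, ∃ K, ∀ x y, |Real.exp (-α m x) - Real.exp (-α m y)| ≤ K * |x - y|)
    (hr : ∀ m, ∃ M, ∀ x, |r m x| ≤ M) (hr' : ∀ m, ∃ K, ∀ x y, |r m x - r m y| ≤ K * |x - y|)
    (n : Fin N) : ∃ K, ∀ x y, |source G α r n x - source G α r n y| ≤ K * |x - y| := by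
  choose K hK using hα
  choose M hM using hr
  choose K' hK' using hr'
  refine ⟨∑ m, G n m * (K' m + Real.exp (M m) * K m), fun x y => ?_⟩
  unfold source
  rw [← Finset.sum_sub_distrib, Finset.sum_mul]
  refine (Finset.abs_sum_le_sum_abs _ _).trans (Finset.sum_le_sum fun m _ => ?_)
  rw [← mul_sub, abs_mul, abs_of_nonneg (hG n m), mul_assoc]
  refine mul_le_mul_of_nonneg_left ?_ (hG n m)
  refine (abs_logShift_sub_le_of_le (M := M m) (by linarith [(abs_le.1 (hM m y)).1])).trans ?_
  have h1 := hK' m x y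
  have h2 := mul_le_mul_of_nonneg_left (hK m x y) (Real.exp_pos (M m)).le
  linarith

/-- Since `logShift` is `1`-Lipschitz in `r` and convolution with `1 / (2π cosh)` has norm `1 / 2`,
the integral operator contracts the vector of sup-distances by the matrix `G / 2`. -/
theorem existsUnique_integral_equation {N : ℕ} {G : Matrix (Fin N) (Fin N) ℝ}
    (hG : G ∈ MatLT2 N) (hG0 : IsNonneg G) {α : Fin N → ℝ → ℝ} (hα : ∀ m, Continuous (α m))
    (hαb : ∀ m, ∃ C, ∀ x, Real.exp (-α m x) ≤ C) :
    ∃! r : Fin N → (ℝ →ᵇ ℝ), ∀ n x, r n x = sechConv (source G α (fun m => r m) n) x := by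
  have hrb : ∀ (r : Fin N → (ℝ →ᵇ ℝ)) (m : Fin N), ∃ M, ∀ x, |r m x| ≤ M :=
    fun r m => ⟨‖r m‖, fun x => (r m).norm_coe_le_norm x⟩
  have hc : ∀ (r : Fin N → (ℝ →ᵇ ℝ)) (n : Fin N), Continuous (source G α (fun m => r m) n) :=
    fun r n => continuous_source G hα (fun m => (r m).continuous) n
  have hb : ∀ (r : Fin N → (ℝ →ᵇ ℝ)) (n : Fin N),
      ∃ M, ∀ x, |source G α (fun m => r m) n x| ≤ M :=
    fun r n => exists_abs_source_le hG0 hαb (hrb r) n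
  choose M hM using hb
  set T : (Fin N → (ℝ →ᵇ ℝ)) → Fin N → (ℝ →ᵇ ℝ) := fun r n =>
    BoundedContinuousFunction.ofNormedAddCommGroup (sechConv (source G α (fun m => r m) n))
      (continuous_sechConv (hc r n) (hM r n)) (M r n / 2) (abs_sechConv_le (hM r n)) with hT
  have hex : ∃! r, T r = r := by
    refine existsUnique_fixedPoint_of_matrix_bound (B := (1 / 2 : ℝ) • G)
      (fun i j => ?_) (tendsto_half_pow hG) fun f g n => ?_
    · rw [Matrix.smul_apply, smul_eq_mul]
      exact mul_nonneg (by norm_num) (hG0 i j)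
    · have hnn : 0 ≤ ∑ m, ((1 / 2 : ℝ) • G) n m * dist (f m) (g m) :=
        Finset.sum_nonneg fun m _ => by
          rw [Matrix.smul_apply, smul_eq_mul]
          exact mul_nonneg (mul_nonneg (by norm_num) (hG0 n m)) dist_nonneg
      refine (BoundedContinuousFunction.dist_le hnn).2 fun x => ?_
      rw [Real.dist_eq]
      change |sechConv _ x - sechConv _ x| ≤ _
      rw [sechConv_sub (hc f n) (hc g n) (hM f n) (hM g n)]
      refine (abs_sechConv_le (M := ∑ m, G n m * dist (f m) (g m)) (fun y => ?_) x).trans ?_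
      · unfold source
        rw [← Finset.sum_sub_distrib]
        refine (Finset.abs_sum_le_sum_abs _ _).trans (Finset.sum_le_sum fun m _ => ?_)
        rw [← mul_sub, abs_mul, abs_of_nonneg (hG0 n m)]
        refine mul_le_mul_of_nonneg_left ((abs_logShift_sub_le _ _ _).trans ?_) (hG0 n m)
        exact BoundedContinuousFunction.dist_coe_le_dist (f := f m) (g := g m) y
      · rw [Finset.sum_div]
        refine le_of_eq (Finset.sum_congr rfl fun m _ => ?_)
        rw [Matrix.smul_apply, smul_eq_mul]
        ring
  have hiff : ∀ r, T r = r ↔ ∀ n x, r n x = sechConv (source G α (fun m => r m) n) x := by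
    intro r
    constructor
    · intro h n x
      conv_lhs => rw [← h]
      rfl
    · intro h
      funext n
      ext x
      exact (h n x).symm
  simpa only [hiff] using hex

/-! ### From the integral equation to the Y-system -/

theorem continuous_comp_of_mem_A {s : ℝ} {f : ℂ → ℂ} (hf : f ∈ A s) {g : ℝ → ℂ}
    (hg : Continuous g) (hgs : ∀ x, g x ∈ closure (strip s)) : Continuous fun x => f (g x) :=
  hf.continuousOn.comp_continuous hg hgs

/-- A continuous function with values in `2πiℤ` is constant. -/
theorem eq_of_exp_eq_one {φ : ℝ → ℂ} (hφ : Continuous φ) (h : ∀ x, Complex.exp (φ x) = 1)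
    (x y : ℝ) : φ x = φ y := by
  have hpi : (2 * Real.pi : ℝ) ≠ 0 := by positivity
  have hint : ∀ x, ∃ n : ℤ, φ x = n * (2 * Real.pi * I) := fun x =>
    Complex.exp_eq_one_iff.1 (h x)
  have hcont : Continuous fun x => (φ x).im / (2 * Real.pi) :=
    (Complex.continuous_im.comp hφ).div_const _
  have hmaps : MapsTo (fun x => (φ x).im / (2 * Real.pi)) univ (range ((↑) : ℤ → ℝ)) := by
    intro x _
    obtain ⟨n, hn⟩ := hint x
    refine ⟨n, ?_⟩
    simp only [hn]
    simp
  have hd : DiscreteTopology (range ((↑) : ℤ → ℝ)) :=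
      Int.isClosedEmbedding_coe_real.toIsEmbedding.toHomeomorph.symm.isEmbedding.discreteTopology
  have himeq := isPreconnected_univ.constant_of_mapsTo ⟨hd⟩ hcont.continuousOn hmaps
    (mem_univ x) (mem_univ y)
  have him : (φ x).im = (φ y).im := by
    have := congrArg (· * (2 * Real.pi)) himeq
    simpa [div_mul_cancel₀ _ hpi] using this
  apply Complex.ext _ him
  obtain ⟨n, hn⟩ := hint x
  obtain ⟨m, hm⟩ := hint y
  rw [hn, hm]
  simp

theorem prod_cpow_eq_exp {ι : Type*} (t : Finset ι) (g τ : ι → ℝ) :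
    ∏ m ∈ t, ((Real.exp (τ m) : ℝ) : ℂ) ^ (g m : ℂ)
      = Complex.exp ((∑ m ∈ t, g m * τ m : ℝ) : ℂ) := by
  rw [Complex.ofReal_sum, Complex.exp_sum]
  refine Finset.prod_congr rfl fun m _ => ?_
  rw [← Complex.ofReal_cpow (Real.exp_pos _).le, ← Real.exp_mul, mul_comm, Complex.ofReal_exp]

namespace IsValidAsymptotics

variable {N : ℕ} {s : ℝ} {G : Matrix (Fin N) (Fin N) ℝ} {a : Fin N → ℂ → ℂ}

theorem eq_ofReal (ha : IsValidAsymptotics s G a) (n : Fin N) (x : ℝ) :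
    a n x = ((a n x).re : ℂ) :=
  Complex.ext rfl (by simpa using ha.real n x)

theorem continuous_re (ha : IsValidAsymptotics s G a) (hs : 0 < s) (n : Fin N) :
    Continuous fun x : ℝ => (a n x).re :=
  Complex.continuous_re.comp (continuous_comp_of_mem_A (ha.mem_A n) Complex.continuous_ofReal
    fun x => subset_closure (ofReal_mem_strip hs x))

theorem exists_exp_neg_le (ha : IsValidAsymptotics s G a) (n : Fin N) :
    ∃ C, ∀ x : ℝ, Real.exp (-(a n x).re) ≤ C := by
  obtain ⟨C, hC⟩ := ha.bounded_exp n
  exact ⟨C, fun x => by simpa [Complex.norm_exp] using hC x⟩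

theorem exists_lipschitz_exp_neg (ha : IsValidAsymptotics s G a) (hs : 0 < s) (n : Fin N) :
    ∃ K, ∀ x y : ℝ, |Real.exp (-(a n x).re) - Real.exp (-(a n y).re)| ≤ K * |x - y| := by
  obtain ⟨K, hK⟩ := ha.bounded_deriv_exp n
  refine ⟨K, fun x y => ?_⟩
  have hd : ∀ t : ℝ, DifferentiableAt ℝ (fun t : ℝ => Complex.exp (-(a n t))) t := fun t =>
    ((((ha.mem_A n).differentiableAt (isOpen_strip s)
      (ofReal_mem_strip hs t)).hasDerivAt.comp_ofReal).neg.cexp).differentiableAt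
  have h := convex_univ.norm_image_sub_le_of_norm_deriv_le (𝕜 := ℝ)
    (f := fun t : ℝ => Complex.exp (-(a n t))) (C := K) (x := y) (y := x)
    (fun t _ => hd t) (fun t _ => hK t) (mem_univ _) (mem_univ _)
  have e : ∀ t : ℝ, Complex.exp (-(a n t)) = ((Real.exp (-(a n t).re) : ℝ) : ℂ) := fun t => by
    rw [ha.eq_ofReal n t]; simp
  simp only [e] at h
  rwa [← Complex.ofReal_sub, Complex.norm_real, Real.norm_eq_abs, Real.norm_eq_abs] at h

/-- On the real line, the right-hand side of the Y-system for `Y = exp (r + a)`. -/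
theorem prod_one_add_cpow (ha : IsValidAsymptotics s G a) {Y : Fin N → ℂ → ℂ} {r : Fin N → ℝ → ℝ}
    {x : ℝ} (hY : ∀ m, Y m x = ((Real.exp (r m x + (a m x).re) : ℝ) : ℂ)) (n : Fin N) :
    ∏ m, (1 + Y m x) ^ (G n m : ℂ) = Complex.exp (source G (fun m x => (a m x).re) r n x
      + (a n (x + I * s) + a n (x - I * s))) := by
  have e : ∀ m : Fin N, (1 : ℂ) + Y m x
      = ((Real.exp (logShift (a m x).re (r m x) + (a m x).re) : ℝ) : ℂ) := fun m => by
    rw [hY, exp_logShift_add]; simp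
  simp only [e]
  rw [prod_cpow_eq_exp, ha.linear_eq]
  congr 1
  simp only [source, mul_add, Finset.sum_add_distrib, Complex.ofReal_add]
  congr 1
  rw [Complex.ofReal_sum]
  refine Finset.sum_congr rfl fun m _ => ?_
  rw [ha.eq_ofReal m x]
  simp

end IsValidAsymptotics

theorem exists_isGoodSolution {N : ℕ} {G : Matrix (Fin N) (Fin N) ℝ} (hG : G ∈ MatLT2 N)
    (hG0 : IsNonneg G) {a : Fin N → ℂ → ℂ} (ha : IsValidAsymptotics (Real.pi / 2) G a) :
    ∃ Y, IsGoodSolution (Real.pi / 2) G a Y := by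
  have hs : 0 < Real.pi / 2 := Real.pi_div_two_pos
  set α : Fin N → ℝ → ℝ := fun n x => (a n x).re with hα
  have hαc : ∀ n, Continuous (α n) := ha.continuous_re hs
  obtain ⟨r, hr, -⟩ := existsUnique_integral_equation hG hG0 hαc ha.exists_exp_neg_le
  have hrb : ∀ m : Fin N, ∃ M, ∀ x, |r m x| ≤ M :=
    fun m => ⟨‖r m‖, fun x => (r m).norm_coe_le_norm x⟩
  have hsc : ∀ n, Continuous (source G α (fun m => r m) n) :=
    continuous_source G hαc fun m => (r m).continuous
  have hsb := exists_abs_source_le hG0 ha.exists_exp_neg_le hrb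
  have hrl : ∀ m, ∃ K, ∀ x y, |r m x - r m y| ≤ K * |x - y| := fun m => by
    obtain ⟨M, hM⟩ := hsb m
    refine ⟨M / 2 * (Real.cos 1)⁻¹, fun x y => ?_⟩
    rw [hr m x, hr m y]
    exact abs_sechConv_sub_le (hsc m) hM x y
  have hsl := exists_lipschitz_source hG0 (ha.exists_lipschitz_exp_neg hs) hrb hrl
  have hext : ∀ n, ∃ F ∈ BA (Real.pi / 2), (∀ x : ℝ, F x = r n x) ∧
      ∀ x : ℝ, F (x + I * (Real.pi / 2 : ℝ)) + F (x - I * (Real.pi / 2 : ℝ))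
        = source G α (fun m => r m) n x := fun n => by
    obtain ⟨M, hM⟩ := hsb n
    obtain ⟨K, hK⟩ := hsl n
    obtain ⟨F, h1, h2, h3⟩ := exists_mem_BA_boundary_sum (hsc n) hM hK
    exact ⟨F, h1, fun x => by rw [h2, hr], h3⟩
  choose F hFBA hFr hFb using hext
  have hhA : ∀ n, (fun z => F n z + a n z) ∈ A (Real.pi / 2) := fun n =>
    DiffContOnCl.add (hFBA n).1 (ha.mem_A n)
  have hYr : ∀ n (x : ℝ), Complex.exp (F n x + a n x)
      = ((Real.exp (r n x + α n x) : ℝ) : ℂ) := fun n x => by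
    rw [hFr, ha.eq_ofReal n x]; simp [hα]
  refine ⟨fun n z => Complex.exp (F n z + a n z), fun n => ?_, fun n x => ?_, fun n x => ?_,
    fun n z _ => Complex.exp_ne_zero _, fun n => ⟨_, ⟨hhA n, fun z _ => rfl⟩, ?_⟩⟩
  · exact Complex.differentiable_exp.comp_diffContOnCl (hhA n)
  · have h := ha.prod_one_add_cpow (Y := fun m z => Complex.exp (F m z + a m z))
      (r := fun m => r m) (hYr · x) n
    refine Eq.trans ?_ h.symm
    rw [← Complex.exp_add, add_add_add_comm, hFb]
  · simp only [hYr]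
    exact ⟨Complex.ofReal_im _, by rw [Complex.ofReal_re]; exact Real.exp_pos _⟩
  · simpa using hFBA n

/-- Every good solution arises from a solution of the integral equation. -/
theorem IsGoodSolution.exists_integral_equation {N : ℕ} {G : Matrix (Fin N) (Fin N) ℝ}
    (hG0 : IsNonneg G) {a Y : Fin N → ℂ → ℂ} (ha : IsValidAsymptotics (Real.pi / 2) G a)
    (hY : IsGoodSolution (Real.pi / 2) G a Y) :
    ∃ r : Fin N → (ℝ →ᵇ ℝ),
      (∀ n x, r n x = sechConv (source G (fun m x => (a m x).re) (fun m => r m) n) x) ∧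
      ∀ n (x : ℝ), Y n x = ((Real.exp (r n x + (a n x).re) : ℝ) : ℂ) := by
  have hs : 0 < Real.pi / 2 := Real.pi_div_two_pos
  set α : Fin N → ℝ → ℝ := fun n x => (a n x).re with hα
  have hαc : ∀ n, Continuous (α n) := ha.continuous_re hs
  choose h hlog hBA using hY.asymptotics
  set f : Fin N → ℂ → ℂ := fun n z => h n z - a n z with hf
  have hreal : ∀ x : ℝ, (x : ℂ) ∈ closure (strip (Real.pi / 2)) := fun x =>
    subset_closure (ofReal_mem_strip hs x)
  have hfb : ∀ n, ∃ C, ∀ z ∈ closure (strip (Real.pi / 2)), ‖f n z‖ ≤ C := fun n => (hBA n).2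
  have hρc : ∀ n, Continuous fun x : ℝ => (f n x).re := fun n =>
    Complex.continuous_re.comp
      (continuous_comp_of_mem_A (hBA n).1 Complex.continuous_ofReal hreal)
  choose C hC using hfb
  have hρb : ∀ n (x : ℝ), |(f n x).re| ≤ C n := fun n x =>
    (Complex.abs_re_le_norm _).trans (hC n _ (hreal x))
  have hρl : ∀ n, ∃ K, ∀ x y : ℝ, |(f n x).re - (f n y).re| ≤ K * |x - y| := fun n => by
    refine ⟨C n, fun x y => ?_⟩
    have h1 := norm_sub_le_of_bounded_on_strip (hBA n).1.differentiableOn (C := C n)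
      (fun z hz => hC n z ((mem_closure_strip hs).2 (hz.trans (by linarith [Real.pi_gt_three]))))
      x y
    rw [← Complex.sub_re]
    exact (Complex.abs_re_le_norm _).trans h1
  set r : Fin N → (ℝ →ᵇ ℝ) := fun n =>
    BoundedContinuousFunction.ofNormedAddCommGroup (fun x : ℝ => (f n x).re) (hρc n) (C n) (hρb n)
    with hr
  have hrf : ∀ n (x : ℝ), r n x = (f n x).re := fun n x => rfl
  have hYr : ∀ n (x : ℝ), Y n x = ((Real.exp (r n x + α n x) : ℝ) : ℂ) := by
    intro n x
    obtain ⟨h1, h2⟩ := hY.real_pos n x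
    have e : r n x + α n x = (h n x).re := by simp [hrf, hf, hα]
    have h3 := congrArg norm ((hlog n).2 x (hreal x))
    rw [Complex.norm_exp] at h3
    have h4 : Y n x = ((Y n x).re : ℂ) := Complex.ext rfl (by simpa using h1)
    rw [e, ← h3, h4, Complex.norm_real, Real.norm_of_nonneg h2.le]
  refine ⟨r, fun n x => ?_, hYr⟩
  have hrb : ∀ m : Fin N, ∃ M, ∀ x, |r m x| ≤ M := fun m => ⟨C m, hρb m⟩
  have hsc : ∀ n, Continuous (source G α (fun m => r m) n) :=
    continuous_source G hαc fun m => (r m).continuous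
  obtain ⟨M, hM⟩ := exists_abs_source_le hG0 ha.exists_exp_neg_le hrb n
  obtain ⟨K, hK⟩ := exists_lipschitz_source hG0 (ha.exists_lipschitz_exp_neg hs) hrb hρl n
  obtain ⟨F, hFBA, hFr, hFb⟩ := exists_mem_BA_boundary_sum (hsc n) hM hK
  set φ : ℝ → ℂ := fun x => f n (x + I * (Real.pi / 2 : ℝ)) + f n (x - I * (Real.pi / 2 : ℝ))
    - source G α (fun m => r m) n x with hφ
  have hexp : ∀ x, Complex.exp (φ x) = 1 := by
    intro x
    have h1 := hY.solves n x
    rw [ha.prod_one_add_cpow (hYr · x), (hlog n).2 _ (add_I_mul_mem_closure_strip hs x),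
      (hlog n).2 _ (sub_I_mul_mem_closure_strip hs x), ← Complex.exp_add] at h1
    have h4 : φ x = (h n (x + I * (Real.pi / 2 : ℝ)) + h n (x - I * (Real.pi / 2 : ℝ)))
        - (source G α (fun m => r m) n x
          + (a n (x + I * (Real.pi / 2 : ℝ)) + a n (x - I * (Real.pi / 2 : ℝ)))) := by
      simp only [hφ, hf]; ring
    rw [h4, Complex.exp_sub, h1, div_self (Complex.exp_ne_zero _)]
  have hφc : Continuous φ := by
    refine Continuous.sub (Continuous.add ?_ ?_) (Complex.continuous_ofReal.comp (hsc n))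
    · exact continuous_comp_of_mem_A (hBA n).1 (by fun_prop) (add_I_mul_mem_closure_strip hs)
    · exact continuous_comp_of_mem_A (hBA n).1 (by fun_prop) (sub_I_mul_mem_closure_strip hs)
  -- The boundary equation holds up to a constant `d ∈ 2πiℤ`, which has no real part.
  set d := φ 0 with hd
  have hdre : d.re = 0 := by
    have := congrArg norm (hexp 0)
    rwa [Complex.norm_exp, norm_one, Real.exp_eq_one_iff] at this
  have hHBA : (fun z => f n z - F z - d / 2) ∈ BA (Real.pi / 2) := by
    obtain ⟨D, hD⟩ := hFBA.2
    refine ⟨(DiffContOnCl.sub (hBA n).1 hFBA.1).sub_const _, C n + D + ‖d / 2‖, fun z hz => ?_⟩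
    refine (norm_sub_le _ _).trans (add_le_add_left ((norm_sub_le _ _).trans ?_) _)
    exact add_le_add (hC n z hz) (hD z hz)
  have hzero := eq_zero_of_boundary_antisymm hs hHBA (fun y => by
    have h1 : φ y = d := eq_of_exp_eq_one hφc hexp y 0
    have h2 := hFb y
    rw [← h1]
    simp only [hφ]
    linear_combination -h2) x
  have h5 := congrArg Complex.re hzero
  simp only [Complex.sub_re, hFr, Complex.ofReal_re, Complex.zero_re] at h5
  have h6 : (d / 2).re = 0 := by simp [hdre]
  rw [hrf]
  linarith

theorem IsGoodSolution.eqOn {N : ℕ} {G : Matrix (Fin N) (Fin N) ℝ} (hG : G ∈ MatLT2 N)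
    (hG0 : IsNonneg G) {a Y Y' : Fin N → ℂ → ℂ} (ha : IsValidAsymptotics (Real.pi / 2) G a)
    (hY : IsGoodSolution (Real.pi / 2) G a Y) (hY' : IsGoodSolution (Real.pi / 2) G a Y')
    (n : Fin N) : EqOn (Y' n) (Y n) (closure (strip (Real.pi / 2))) := by
  have hs : 0 < Real.pi / 2 := Real.pi_div_two_pos
  obtain ⟨r, h1, h2⟩ := hY.exists_integral_equation hG0 ha
  obtain ⟨r', h1', h2'⟩ := hY'.exists_integral_equation hG0 ha
  have hrr : r' = r := (existsUnique_integral_equation hG hG0 (ha.continuous_re hs)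
    ha.exists_exp_neg_le).unique h1' h1
  refine eqOn_closure_strip_of_eq_on_real hs (hY'.mem_A n) (hY.mem_A n) fun x => ?_
  rw [h2, h2', hrr]

/-! ### Rescaling the strip -/

theorem mul_mem_strip {s t c : ℝ} (hc : 0 < c) (ht : t = c * s) {z : ℂ} (hz : z ∈ strip s) :
    (c * z : ℂ) ∈ strip t := by
  have h1 := mul_lt_mul_of_pos_left hz.1 hc
  have h2 := mul_lt_mul_of_pos_left hz.2 hc
  refine ⟨?_, ?_⟩ <;> rw [Complex.im_ofReal_mul, ht]
  · rwa [← mul_neg]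
  · exact h2

theorem mul_mem_closure_strip {s t c : ℝ} (hc : 0 < c) (ht : t = c * s) {z : ℂ}
    (hz : z ∈ closure (strip s)) : (c * z : ℂ) ∈ closure (strip t) :=
  map_mem_closure (continuous_const_mul _) hz fun _ hw => mul_mem_strip hc ht hw

theorem comp_mul_mem_A {s t c : ℝ} {f : ℂ → ℂ} (hf : f ∈ A t) (hc : 0 < c) (ht : t = c * s) :
    (fun z => f (c * z)) ∈ A s :=
  DiffContOnCl.comp hf (Differentiable.diffContOnCl (by fun_prop)) fun _ hz =>
    mul_mem_strip hc ht hz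

theorem mul_add_I_mul {s t c : ℝ} (ht : t = c * s) (x : ℝ) :
    (c * (x + I * s) : ℂ) = (c * x : ℝ) + I * t := by
  rw [ht]; push_cast; ring

theorem mul_sub_I_mul {s t c : ℝ} (ht : t = c * s) (x : ℝ) :
    (c * (x - I * s) : ℂ) = (c * x : ℝ) - I * t := by
  rw [ht]; push_cast; ring

theorem IsValidAsymptotics.comp_mul {N : ℕ} {G : Matrix (Fin N) (Fin N) ℝ} {a : Fin N → ℂ → ℂ}
    {s t c : ℝ} (ha : IsValidAsymptotics t G a) (hc : 0 < c)
    (ht : t = c * s) : IsValidAsymptotics s G fun n z => a n (c * z) := by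
  refine ⟨fun n => comp_mul_mem_A (ha.mem_A n) hc ht, fun n x => ?_, fun n => ?_, fun n => ?_,
    fun n x => ?_⟩
  · rw [← Complex.ofReal_mul]
    exact ha.real n _
  · obtain ⟨C, hC⟩ := ha.bounded_exp n
    exact ⟨C, fun x => by rw [← Complex.ofReal_mul]; exact hC _⟩
  · obtain ⟨C, hC⟩ := ha.bounded_deriv_exp n
    refine ⟨c * C, fun x => ?_⟩
    have h := deriv_comp_mul_left c (fun t : ℝ => Complex.exp (-(a n t))) x
    simp only [Complex.ofReal_mul] at h
    rw [h, norm_smul, Real.norm_of_nonneg hc.le]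
    exact mul_le_mul_of_nonneg_left (hC _) hc.le
  · have h := ha.linear_eq n (c * x)
    rw [mul_add_I_mul ht, mul_sub_I_mul ht, h]
    simp only [Complex.ofReal_mul]

theorem IsGoodSolution.comp_mul {N : ℕ} {G : Matrix (Fin N) (Fin N) ℝ} {a Y : Fin N → ℂ → ℂ}
    {s t c : ℝ} (hY : IsGoodSolution t G a Y) (hc : 0 < c) (ht : t = c * s) :
    IsGoodSolution s G (fun n z => a n (c * z)) (fun n z => Y n (c * z)) := by
  refine ⟨fun n => comp_mul_mem_A (hY.mem_A n) hc ht, fun n x => ?_, fun n x => ?_,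
    fun n z hz => hY.no_roots n _ (mul_mem_closure_strip hc ht hz), fun n => ?_⟩
  · have h := hY.solves n (c * x)
    rw [mul_add_I_mul ht, mul_sub_I_mul ht, h]
    simp only [Complex.ofReal_mul]
  · rw [← Complex.ofReal_mul]
    exact hY.real_pos n _
  · obtain ⟨h, ⟨hA, hlog⟩, hBA, C, hC⟩ := hY.asymptotics n
    exact ⟨fun z => h (c * z), ⟨comp_mul_mem_A hA hc ht, fun z hz =>
      hlog _ (mul_mem_closure_strip hc ht hz)⟩, comp_mul_mem_A hBA hc ht, C,
      fun z hz => hC _ (mul_mem_closure_strip hc ht hz)⟩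

end YSystem

theorem mainTheorem1 (N : ℕ) (hN : 0 < N) (s : ℝ) (hs : 0 < s)
    (G : Matrix (Fin N) (Fin N) ℝ) (hG : G ∈ YSystem.MatLT2 N)
    (hG_nonneg : YSystem.IsNonneg G) (hG_irred : YSystem.IsIrred G)
    (a : Fin N → ℂ → ℂ) (ha : YSystem.IsValidAsymptotics s G a) :
    ∃ Y : Fin N → ℂ → ℂ, YSystem.IsGoodSolution s G a Y ∧
      ∀ Y' : Fin N → ℂ → ℂ, YSystem.IsGoodSolution s G a Y' →
        ∀ n, Set.EqOn (Y' n) (Y n) (closure (YSystem.strip s)) := by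
  -- The substitution `z ↦ c * z` reduces to half-height `π / 2`.
  have hpi : 0 < Real.pi / 2 := Real.pi_div_two_pos
  obtain ⟨c, hc⟩ : ∃ c : ℝ, c = Real.pi / 2 / s := ⟨_, rfl⟩
  have hc0 : 0 < c := hc ▸ div_pos hpi hs
  have hcs : Real.pi / 2 = c * s := by rw [hc]; field_simp
  have hcs' : s = c⁻¹ * (Real.pi / 2) := by rw [hcs]; field_simp
  have hcC : (c : ℂ) ≠ 0 := by exact_mod_cast hc0.ne'
  have ha' := ha.comp_mul (inv_pos.2 hc0) hcs'
  obtain ⟨Y, hY⟩ := YSystem.exists_isGoodSolution hG hG_nonneg ha'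
  have hY1 := hY.comp_mul hc0 hcs
  simp only [Complex.ofReal_inv, inv_mul_cancel_left₀ hcC] at hY1
  refine ⟨_, hY1, fun Y' hY' n z hz => ?_⟩
  have h := YSystem.IsGoodSolution.eqOn hG hG_nonneg ha' hY
    (hY'.comp_mul (inv_pos.2 hc0) hcs') n (YSystem.mul_mem_closure_strip hc0 hcs hz)
  simpa only [Complex.ofReal_inv, inv_mul_cancel_left₀ hcC] using h
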